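/- Let $G$ be a Lie group with a bi-invariant Riemannian metric, $H<G$ a closed subgroup, $\mathfrak h\subset\mathfrak g$ their Lie algebras, $\pi:G\to X:=G/H$ the quotient map, $M$ a smooth manifold and $\varphi:M\to X$ a smooth map. Let $\varphi^*G=\{(m,g)\in M\times G\mid\varphi(m)=gH\}$ be the coset bundle (a principal $H$-bundle over $M$ with the projection $\pi_1(m,g)=m$), and let $g^{-1}dg$ also denote the pullback to $\varphi^*G$ of the left-invariant Maurer–Cartan form of $G$. For $x=gH\in X$ put $\mathfrak h_x:=\mathrm{Ad}(g)\mathfrak h$; for a $\mathfrak g$-valued form $r$ on $M$ let $r^\parallel:=\mathrm{pr}_{\mathfrak h_\varphi}(r)$ be its pointwise orthogonal projection to $\mathfrak h_{\varphi(m)}$. The coisotropy form $\omega^\perp$ is the $\mathfrak g$-valued $1$-form on $X$ with $\pi^*\omega^\perp=\mathrm{Ad}(g)\,\mathrm{pr}_{\mathfrak h^\perp}(g^{-1}dg)$. For $\mathfrak g$-valued $1$-forms, $(\alpha\wedge\alpha)(X,Y)=[\alpha(X),\alpha(Y)]$ and $[\alpha,\beta](X,Y)=[\alpha(X),\beta(Y)]-[\alpha(Y),\beta(X)]$.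 The untwisted potential of a connection form $B$ on $\varphi^*G$ is the $\mathfrak g$-valued $1$-form $b$ on $M$ with $\pi_1^*b=\mathrm{Ad}(g)\bigl(B-\mathrm{pr}_{\mathfrak h}(g^{-1}dg)\bigr)$; its curvature potential $F(b)$ is the $\mathfrak g$-valued $2$-form on $M$ with $\pi_1^*F(b)=\mathrm{Ad}(g)(dB+B\wedge B)$. For a smooth map $w:M\to G$ with $w(m)\varphi(m)=\varphi(m)$ for all $m$ (a section of $H_\varphi$), let $f_w(m,g)=(m,w(m)g)$ be the corresponding gauge transformation of $\varphi^*G$ and let $b^w$ be the untwisted potential of $f_w^*B$. Then for every smooth connection $B$ on $\varphi^*G$ with untwisted potential $b$ and every smooth section $w$ of $H_\varphi$: (i) $b^w=\mathrm{Ad}(w^{-1})b+w^{-1}dw-(\mathrm{Ad}(w^{-1})-I)\varphi^*\omega^\perp$; (ii) $F(b^w)=\mathrm{Ad}(w^{-1})F(b)$; (iii) $F(b)=db+b\wedge b-[b,\varphi^*\omega^\perp]-(\varphi^*\omega^\perp\wedge\varphi^*\omega^\perp)^\parallel$. -/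

import Mathlib

open scoped Manifold ContDiff Topology

noncomputable section

namespace CosetGauge

/-! ### Differential forms on smooth manifolds -/

section Forms

variable {E : Type*} [NormedAddCommGroup E] [NormedSpace ℝ E]
  {M : Type*} [TopologicalSpace M] [ChartedSpace E M]
  {E' : Type*} [NormedAddCommGroup E'] [NormedSpace ℝ E']
  {M' : Type*} [TopologicalSpace M'] [ChartedSpace E' M']
  {V : Type*} [NormedAddCommGroup V] [NormedSpace ℝ V] {k : ℕ}

/-- `V`-valued differential `k`-forms on a manifold `M` modelled on `E` (not necessarily smooth). -/
abbrev DForm (E : Type*) [NormedAddCommGroup E] [NormedSpace ℝ E]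
    (M : Type*) [TopologicalSpace M] [ChartedSpace E M]
    (V : Type*) [NormedAddCommGroup V] [NormedSpace ℝ V] (k : ℕ) :=
  ∀ p : M, TangentSpace 𝓘(ℝ, E) p [⋀^Fin k]→L[ℝ] V

/-- The expression of a form in the preferred chart at `p`: its pullback under the inverse of the
chart (meaningful on the target of the chart). -/
def DForm.inChart (α : DForm E M V k) (p : M) : E → E [⋀^Fin k]→L[ℝ] V := fun x =>
  (α ((extChartAt 𝓘(ℝ, E) p).symm x)).compContinuousLinearMap
    (mfderiv 𝓘(ℝ, E) 𝓘(ℝ, E) (extChartAt 𝓘(ℝ, E) p).symm x)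

/-- A form is smooth if all its chart expressions are smooth. -/
def DForm.IsSmooth (α : DForm E M V k) : Prop :=
  ∀ p : M, ContDiffOn ℝ ∞ (α.inChart p) (extChartAt 𝓘(ℝ, E) p).target

/-- The exterior derivative, computed at `p` in the preferred chart at `p`. -/
def DForm.d (α : DForm E M V k) : DForm E M V (k + 1) := fun p =>
  (extDeriv (α.inChart p) (extChartAt 𝓘(ℝ, E) p p)).compContinuousLinearMap
    (mfderiv 𝓘(ℝ, E) 𝓘(ℝ, E) (extChartAt 𝓘(ℝ, E) p) p)

/-- The pullback `f^* α`. -/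
def DForm.pullback (f : M → M') (α : DForm E' M' V k) : DForm E M V k := fun p =>
  (α (f p)).compContinuousLinearMap (mfderiv 𝓘(ℝ, E) 𝓘(ℝ, E') f p)

/-- Apply a point-dependent endomorphism of the coefficients to a form. -/
def DForm.mapCoeff (L : M → V →L[ℝ] V) (α : DForm E M V k) : DForm E M V k := fun p =>
  (L p).compContinuousAlternatingMap (α p)

end Forms

/-! ### Lie groups

The Lie algebra `𝔤 = T₁G` of a Lie group modelled on `E` is the tangent space at the identity,
which is the vector space `E` by definition. -/

section LieGroup

variable (E : Type*) [NormedAddCommGroup E] [NormedSpace ℝ E]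
  {G : Type*} [TopologicalSpace G] [ChartedSpace E G] [Group G]

/-- The adjoint action `Ad_*(g)` on `𝔤`, the derivative of `x ↦ g x g⁻¹` at the identity. -/
def Ad (g : G) : E →L[ℝ] E :=
  mfderiv 𝓘(ℝ, E) 𝓘(ℝ, E) (fun x : G => g * x * g⁻¹) (1 : G)

/-- The linear map `η ↦ g⁻¹ η` from `T_g G` to `𝔤`. -/
def leftTriv (g : G) : TangentSpace 𝓘(ℝ, E) g →L[ℝ] E :=
  mfderiv 𝓘(ℝ, E) 𝓘(ℝ, E) (fun x : G => g⁻¹ * x) g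

variable (G) in
/-- The left-invariant Maurer-Cartan form `g⁻¹ dg`. -/
def maurerCartan : DForm E G E 1 := fun g =>
  ContinuousAlternatingMap.ofSubsingleton ℝ (TangentSpace 𝓘(ℝ, E) g) E (0 : Fin 1) (leftTriv E g)

variable [FiniteDimensional ℝ E] [LieGroup 𝓘(ℝ, E) ∞ G]

variable (G) in
/-- The Lie bracket of `𝔤` (Mathlib's bracket on `GroupLieAlgebra`, the bracket of left-invariant
vector fields), as a continuous bilinear map. -/
def bracketL : E →L[ℝ] E →L[ℝ] E :=
  haveI := FiniteDimensional.complete ℝ E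
  haveI : LieGroup 𝓘(ℝ, E) (minSmoothness ℝ 3) G :=
    LieGroup.of_le (n := ∞) (by
      rw [minSmoothness_of_isRCLikeNormedField]; exact ENat.LEInfty.out)
  LinearMap.toContinuousLinearMap
    ((LinearMap.toContinuousLinearMap : (E →ₗ[ℝ] E) ≃ₗ[ℝ] (E →L[ℝ] E)).toLinearMap ∘ₗ
      LinearMap.mk₂ ℝ
        (fun u v : GroupLieAlgebra 𝓘(ℝ, E) G => (⁅u, v⁆ : GroupLieAlgebra 𝓘(ℝ, E) G))
        (fun u u' v => add_lie (L := GroupLieAlgebra 𝓘(ℝ, E) G)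
          (M := GroupLieAlgebra 𝓘(ℝ, E) G) u u' v)
        (fun c u v => smul_lie (L := GroupLieAlgebra 𝓘(ℝ, E) G)
          (M := GroupLieAlgebra 𝓘(ℝ, E) G) c u v)
        (fun u v v' => lie_add (L := GroupLieAlgebra 𝓘(ℝ, E) G)
          (M := GroupLieAlgebra 𝓘(ℝ, E) G) u v v')
        (fun c u v => lie_smul (L := GroupLieAlgebra 𝓘(ℝ, E) G)
          (M := GroupLieAlgebra 𝓘(ℝ, E) G) c u v))

theorem bracketL_apply (u v : GroupLieAlgebra 𝓘(ℝ, E) G) : bracketL E G u v = ⁅u, v⁆ := rfl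

variable {E} {F : Type*} [NormedAddCommGroup F] [NormedSpace ℝ F]

variable (G) in
/-- The bracket of two `𝔤`-valued alternating `1`-forms on a vector space,
`[β, γ](X, Y) = [β X, γ Y] - [β Y, γ X]`. -/
def bracketForm (β γ : F [⋀^Fin 1]→L[ℝ] E) : F [⋀^Fin 2]→L[ℝ] E :=
  ContinuousAlternatingMap.alternatizeUncurryFin
    (((ContinuousAlternatingMap.ofSubsingletonLIE (𝕜 := ℝ) (E := F) (F := E)
      (0 : Fin 1)).toContinuousLinearEquiv : (F →L[ℝ] E) →L[ℝ] F [⋀^Fin 1]→L[ℝ] E) ∘L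
      (bracketL E G).bilinearComp
        ((ContinuousAlternatingMap.ofSubsingleton ℝ F E (0 : Fin 1)).symm β)
        ((ContinuousAlternatingMap.ofSubsingleton ℝ F E (0 : Fin 1)).symm γ))

theorem bracketForm_apply (β γ : F [⋀^Fin 1]→L[ℝ] E) (X Y : F) :
    bracketForm G β γ ![X, Y] =
      bracketL E G (β ![X]) (γ ![Y]) - bracketL E G (β ![Y]) (γ ![X]) := by
  have h : ∀ Z : F, (fun _ : Fin 1 => Z) = ![Z] := fun Z => by ext i; fin_cases i; rfl
  simp [bracketForm, ContinuousAlternatingMap.alternatizeUncurryFin_apply, Fin.sum_univ_two, h,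
    sub_eq_add_neg, Fin.removeNth]

variable (G) in
/-- `β ∧ β` for a `𝔤`-valued alternating `1`-form, `(β ∧ β)(X, Y) = [β X, β Y]`. -/
def wedgeSelf (β : F [⋀^Fin 1]→L[ℝ] E) : F [⋀^Fin 2]→L[ℝ] E :=
  (1 / 2 : ℝ) • bracketForm G β β

theorem wedgeSelf_apply (β : F [⋀^Fin 1]→L[ℝ] E) (X Y : F) :
    wedgeSelf G β ![X, Y] = bracketL E G (β ![X]) (β ![Y]) := by
  have h : bracketL E G (β ![Y]) (β ![X]) = - bracketL E G (β ![X]) (β ![Y]) := by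
    have := FiniteDimensional.complete ℝ E
    have : LieGroup 𝓘(ℝ, E) (minSmoothness ℝ 3) G :=
      LieGroup.of_le (n := ∞) (by
        rw [minSmoothness_of_isRCLikeNormedField]; exact ENat.LEInfty.out)
    exact (lie_skew (L := GroupLieAlgebra 𝓘(ℝ, E) G) _ _).symm
  rw [wedgeSelf, ContinuousAlternatingMap.smul_apply, bracketForm_apply, h, sub_neg_eq_add,
    ← two_smul ℝ, smul_smul]
  norm_num

end LieGroup

/-! ### Homogeneous spaces with a bi-invariant metric -/

section Homogeneous

variable {E : Type*} [NormedAddCommGroup E] [NormedSpace ℝ E]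
  {G : Type*} [TopologicalSpace G] [ChartedSpace E G] [Group G] [LieGroup 𝓘(ℝ, E) ∞ G]

/-- The Lie algebra `𝔥` of a (closed) subgroup `H` of `G`, as a subspace of `𝔤`: the velocities
at `0` of the smooth curves in `G` through the identity that stay in `H`. -/
def subgroupLie (H : Subgroup G) : Submodule ℝ E where
  carrier := {ξ | ∃ γ : ℝ → G, γ 0 = 1 ∧ (∀ t, γ t ∈ H) ∧
    ContMDiffAt 𝓘(ℝ, ℝ) 𝓘(ℝ, E) ∞ γ 0 ∧ (mfderiv 𝓘(ℝ, ℝ) 𝓘(ℝ, E) γ 0 : ℝ →L[ℝ] E) 1 = ξ}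
  zero_mem' := by
    refine ⟨fun _ => 1, rfl, fun _ => H.one_mem, contMDiffAt_const, ?_⟩
    rw [mfderiv_const]; rfl
  add_mem' := by
    rintro ξ ξ' ⟨γ, h0, hH, hs, rfl⟩ ⟨γ', h0', hH', hs', rfl⟩
    refine ⟨fun t => γ t * γ' t, by simp [h0, h0'], fun t => H.mul_mem (hH t) (hH' t),
      hs.mul hs', ?_⟩
    have hm : MDifferentiableAt (𝓘(ℝ, E).prod 𝓘(ℝ, E)) 𝓘(ℝ, E)
        (fun p : G × G => p.1 * p.2) (γ 0, γ' 0) :=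
      (contMDiff_mul 𝓘(ℝ, E) ∞).mdifferentiableAt (by simp)
    have hd := hs.mdifferentiableAt (n := ∞) (by simp)
    have hd' := hs'.mdifferentiableAt (n := ∞) (by simp)
    have h1 := mfderiv_comp_apply (I := 𝓘(ℝ, ℝ)) (f := fun t => (γ t, γ' t)) (0 : ℝ) hm
      (hd.prodMk hd') (1 : ℝ)
    rw [mfderiv_prodMk hd hd', mfderiv_prod_eq_add_apply hm] at h1
    have aux : ∀ f : G → G, f = id → ∀ x, (mfderiv 𝓘(ℝ, E) 𝓘(ℝ, E) f x : E →L[ℝ] E) = .id ℝ E := by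
      rintro _ rfl x
      exact mfderiv_id
    exact h1.trans (congrArg₂ (fun x y : E => x + y)
      (DFunLike.congr_fun (aux (fun z => z * γ' 0) (by ext; simp [h0']) (γ 0)) _)
      (DFunLike.congr_fun (aux (fun z => γ 0 * z) (by ext; simp [h0]) (γ' 0)) _))
  smul_mem' := by
    rintro c ξ ⟨γ, h0, hH, hs, rfl⟩
    have hl : MDifferentiableAt 𝓘(ℝ, ℝ) 𝓘(ℝ, ℝ) (fun t : ℝ => c * t) 0 :=
      (differentiableAt_id.const_mul c).mdifferentiableAt
    have hs' : ContMDiffAt 𝓘(ℝ, ℝ) 𝓘(ℝ, E) ∞ γ (c * 0) := by rwa [mul_zero]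
    refine ⟨fun t => γ (c * t), by simp [h0], fun t => hH _,
      hs'.comp (0 : ℝ) (contDiff_const.mul contDiff_id).contMDiff.contMDiffAt, ?_⟩
    have h1 := mfderiv_comp_apply (I := 𝓘(ℝ, ℝ)) (g := γ) (f := fun t : ℝ => c * t) (0 : ℝ)
      (hs'.mdifferentiableAt (by simp)) hl (1 : ℝ)
    have h2 : (mfderiv 𝓘(ℝ, ℝ) 𝓘(ℝ, ℝ) (fun t : ℝ => c * t) 0 : ℝ →L[ℝ] ℝ) 1 = c := by
      have h3 : HasFDerivAt (fun t : ℝ => c * t) (c • ContinuousLinearMap.id ℝ ℝ) 0 :=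
        (hasFDerivAt_id _).const_mul c
      rw [h3.hasMFDerivAt.mfderiv]
      exact mul_one c
    have h3 : ∀ r : ℝ, r = 0 → (mfderiv 𝓘(ℝ, ℝ) 𝓘(ℝ, E) γ r : ℝ →L[ℝ] E) c =
        c • (mfderiv 𝓘(ℝ, ℝ) 𝓘(ℝ, E) γ 0 : ℝ →L[ℝ] E) 1 := by
      rintro _ rfl
      refine Eq.trans ?_ (ContinuousLinearMap.map_smul
        (mfderiv 𝓘(ℝ, ℝ) 𝓘(ℝ, E) γ 0 : ℝ →L[ℝ] E) c (1 : ℝ))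
      exact congrArg (mfderiv 𝓘(ℝ, ℝ) 𝓘(ℝ, E) γ 0 : ℝ →L[ℝ] E) (mul_one c).symm
    exact h1.trans ((congrArg (mfderiv 𝓘(ℝ, ℝ) 𝓘(ℝ, E) γ (c * 0) : ℝ →L[ℝ] E) h2).trans
      (h3 _ (mul_zero c)))

variable [FiniteDimensional ℝ E]

variable (E G) in
/-- Riemannian metrics on `G`. -/
abbrev Metric :=
  Bundle.ContMDiffRiemannianMetric 𝓘(ℝ, E) ∞ E (fun x : G => TangentSpace 𝓘(ℝ, E) x)

/-- Invariance of a Riemannian metric under all left and right translations. -/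
def IsBiInvariant (met : Metric E G) : Prop :=
  ∀ (g x : G) (u v : TangentSpace 𝓘(ℝ, E) x),
    met.inner (g * x) (mfderiv 𝓘(ℝ, E) 𝓘(ℝ, E) (fun y : G => g * y) x u)
      (mfderiv 𝓘(ℝ, E) 𝓘(ℝ, E) (fun y : G => g * y) x v) = met.inner x u v ∧
    met.inner (x * g) (mfderiv 𝓘(ℝ, E) 𝓘(ℝ, E) (fun y : G => y * g) x u)
      (mfderiv 𝓘(ℝ, E) 𝓘(ℝ, E) (fun y : G => y * g) x v) = met.inner x u v

/-- The inner product of the metric on `𝔤 = T₁G`, as a bilinear form. -/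
def innerForm (met : Metric E G) : LinearMap.BilinForm ℝ E :=
  let L : E →L[ℝ] E →L[ℝ] ℝ := met.inner 1
  LinearMap.mk₂ ℝ (fun u v : E => L u v) (fun u u' v => by simp) (fun c u v => by simp)
    (fun u v v' => by simp) (fun c u v => by simp)

theorem isCompl_orthogonal (met : Metric E G) (W : Submodule ℝ E) :
    IsCompl W ((innerForm met).orthogonal W) := by
  have hr : (innerForm met).IsRefl := fun u v h => (met.symm 1 v u).trans h
  rw [LinearMap.BilinForm.isCompl_orthogonal_iff_disjoint hr, Submodule.disjoint_def]
  intro u hu hu'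
  by_contra h
  exact (met.pos 1 u h).ne' (hu' u hu)

/-- Orthogonal projection `pr_W` of `𝔤` onto a subspace `W`. -/
def prPar (met : Metric E G) (W : Submodule ℝ E) : E →L[ℝ] E :=
  LinearMap.toContinuousLinearMap (W.projection _ (isCompl_orthogonal met W))

/-- Orthogonal projection of `𝔤` onto the orthogonal complement of a subspace `W`. -/
def prPerp (met : Metric E G) (W : Submodule ℝ E) : E →L[ℝ] E :=
  LinearMap.toContinuousLinearMap
    (((innerForm met).orthogonal W).projection _ (isCompl_orthogonal met W).symm)

/-- The isotropy subalgebra `𝔥_x = {ξ | g⁻¹ ξ g ∈ 𝔥}` of a point `x = gH` of `G/H` (it does not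
depend on the representative `g`). -/
def isotropyLie (H : Subgroup G) (x : G ⧸ H) : Submodule ℝ E where
  carrier := {ξ | ∀ g : G, (g : G ⧸ H) = x → Ad E g⁻¹ ξ ∈ subgroupLie (E := E) H}
  zero_mem' := fun g _ => by simp
  add_mem' := fun {a b} ha hb g hg => by
    rw [map_add]; exact add_mem (ha g hg) (hb g hg)
  smul_mem' := fun c a ha g hg => by
    rw [map_smul]; exact Submodule.smul_mem _ c (ha g hg)

variable {EX : Type*} [NormedAddCommGroup EX] [NormedSpace ℝ EX]
  {H : Subgroup G} [ChartedSpace EX (G ⧸ H)]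

/-- The smooth structure on `G/H` is the standard one: the quotient map `G → G/H` is a smooth
submersion (this determines the smooth structure). -/
abbrev IsQuotientStructure (E EX : Type*) [NormedAddCommGroup E] [NormedSpace ℝ E]
    [NormedAddCommGroup EX] [NormedSpace ℝ EX]
    {G : Type*} [TopologicalSpace G] [ChartedSpace E G] [Group G]
    (H : Subgroup G) [ChartedSpace EX (G ⧸ H)] : Prop :=
  Manifold.IsSubmersion 𝓘(ℝ, E) 𝓘(ℝ, EX) ∞ (QuotientGroup.mk : G → G ⧸ H)


theorem exists_lift [IsManifold 𝓘(ℝ, EX) ∞ (G ⧸ H)] (hπ : IsQuotientStructure E EX H) (g : G) :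
    ∃ s : TangentSpace 𝓘(ℝ, EX) (g : G ⧸ H) →L[ℝ] TangentSpace 𝓘(ℝ, E) g,
      ∀ S, mfderiv 𝓘(ℝ, E) 𝓘(ℝ, EX) (QuotientGroup.mk : G → G ⧸ H) g (s S) = S := by
  obtain ⟨F, _, _, hF⟩ := hπ
  have h := hF g
  set e := h.equiv
  set a := h.domChart
  set c := h.codChart
  have hga : g ∈ a.source := h.mem_domChart_source
  have hgc : (g : G ⧸ H) ∈ c.source := h.mem_codChart_source
  have key : ∀ x ∈ a.target, c ((a.symm x : G) : G ⧸ H) = (e x).1 := fun x hx => by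
    have hx' : x ∈ (a.extend 𝓘(ℝ, E)).target := by simpa using hx
    have := h.writtenInCharts hx'
    simpa using this
  have hcg : c (g : G ⧸ H) = (e (a g)).1 := by
    have := key (a g) (a.map_source hga)
    rwa [a.left_inv hga] at this
  let σ : G ⧸ H → G := fun y => a.symm (e.symm (c y, (e (a g)).2))
  have hσg : e.symm (c (g : G ⧸ H), (e (a g)).2) = a g := by
    rw [hcg]; exact e.symm_apply_apply _
  have hc : MDifferentiableAt 𝓘(ℝ, EX) 𝓘(ℝ, EX) c (g : G ⧸ H) :=
    (contMDiffAt_of_mem_maximalAtlas h.codChart_mem_maximalAtlas hgc).mdifferentiableAt (by simp)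
  have hin : MDifferentiableAt 𝓘(ℝ, EX) 𝓘(ℝ, E)
      (fun y => e.symm (c y, (e (a g)).2)) (g : G ⧸ H) :=
    (e.symm.toContinuousLinearMap.mdifferentiableAt).comp _
      (hc.prodMk_space mdifferentiableAt_const)
  have ha : MDifferentiableAt 𝓘(ℝ, E) 𝓘(ℝ, E) a.symm
      (e.symm (c (g : G ⧸ H), (e (a g)).2)) :=
    (contMDiffAt_symm_of_mem_maximalAtlas h.domChart_mem_maximalAtlas
      (by rw [hσg]; exact a.map_source hga)).mdifferentiableAt (by simp)
  have hσ : MDifferentiableAt 𝓘(ℝ, EX) 𝓘(ℝ, E) σ (g : G ⧸ H) :=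
    MDifferentiableAt.comp (g := a.symm) (f := fun y => e.symm (c y, (e (a g)).2)) _ ha hin
  have hσ' : σ (g : G ⧸ H) = g := by
    simp only [σ]; rw [hσg, a.left_inv hga]
  have hπ : MDifferentiableAt 𝓘(ℝ, E) 𝓘(ℝ, EX) (QuotientGroup.mk : G → G ⧸ H) (σ g) := by
    rw [hσ']; exact (h.contMDiffAt).mdifferentiableAt (by simp)
  have hid : (QuotientGroup.mk ∘ σ : G ⧸ H → G ⧸ H) =ᶠ[𝓝 (g : G ⧸ H)] id := by
    have h1 : ∀ᶠ y in 𝓝 (g : G ⧸ H), y ∈ c.source := c.open_source.mem_nhds hgc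
    have h2 : ∀ᶠ y in 𝓝 (g : G ⧸ H), e.symm (c y, (e (a g)).2) ∈ a.target :=
      hin.continuousAt.eventually (a.open_target.mem_nhds (by simp only [hσg]; exact a.map_source hga))
    filter_upwards [h1, h2] with y hy1 hy2
    have h3 := key _ hy2
    rw [ContinuousLinearEquiv.apply_symm_apply] at h3
    exact c.injOn (h.source_subset_preimage_source (a.map_target hy2)) hy1 h3
  have hcomp := mfderiv_comp (g : G ⧸ H) hπ hσ
  rw [hid.mfderiv_eq, mfderiv_id] at hcomp
  have gen : ∀ g', σ (g : G ⧸ H) = g' → ∃ s : EX →L[ℝ] E, ∀ S : EX,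
      (mfderiv 𝓘(ℝ, E) 𝓘(ℝ, EX) (QuotientGroup.mk : G → G ⧸ H) g' : E →L[ℝ] EX) (s S) = S := by
    rintro _ rfl
    exact ⟨mfderiv 𝓘(ℝ, EX) 𝓘(ℝ, E) σ (g : G ⧸ H), fun S => (DFunLike.congr_fun hcomp S).symm⟩
  exact gen g hσ'

variable [IsManifold 𝓘(ℝ, EX) ∞ (G ⧸ H)]

/-- The coisotropy form of `G/H`: `x = gH`, `S ∈ T_x(G/H)` is lifted to a vector `η ∈ T_g G` with
`π_* η = S` and sent to `Ad_*(g) pr_{𝔥^⊥}(g⁻¹ η)`. -/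
def coisotropyForm (met : Metric E G) (hπ : IsQuotientStructure E EX H) :
    DForm EX (G ⧸ H) E 1 := fun x =>
  ContinuousAlternatingMap.ofSubsingleton ℝ EX E (0 : Fin 1)
    (Ad E x.out ∘L prPerp met (subgroupLie H) ∘L leftTriv E x.out ∘L
      (exists_lift hπ x.out).choose)

end Homogeneous

/-! ### Coset bundles, connections and untwisted potentials -/

section CosetBundle

variable {E : Type*} [NormedAddCommGroup E] [NormedSpace ℝ E] [FiniteDimensional ℝ E]
  {G : Type*} [TopologicalSpace G] [ChartedSpace E G] [Group G] [LieGroup 𝓘(ℝ, E) ∞ G]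
  {H : Subgroup G}
  {EM : Type*} [NormedAddCommGroup EM] [NormedSpace ℝ EM]
  {M : Type*} [TopologicalSpace M] [ChartedSpace EM M]

/-- The coset bundle `φ^* G = {(m, g) | φ m = g H}`. -/
abbrev CosetBundle (φ : M → G ⧸ H) : Type _ := {p : M × G // φ p.1 = (p.2 : G ⧸ H)}

namespace CosetBundle

variable {φ : M → G ⧸ H}

/-- The bundle projection `π₁ : φ^* G → M`. -/
def π₁ (p : CosetBundle φ) : M := p.1.1

/-- The canonical map `π₂ : φ^* G → G`. -/
def π₂ (p : CosetBundle φ) : G := p.1.2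

/-- The right action `(m, g) ↦ (m, g h)` of the structure group `H`. -/
def rightMul (h : H) (p : CosetBundle φ) : CosetBundle φ :=
  ⟨(p.1.1, p.1.2 * h), by rw [p.2]; exact (QuotientGroup.mk_mul_of_mem _ h.2).symm⟩

/-- The gauge transformation `f_w (m, g) = (m, w(m) g)` of a section `w` of `H_φ`, i.e. of a map
`w : M → G` such that `w m` lies in the isotropy subgroup of `φ m`. -/
def gaugeMap (w : M → G) (hw : ∀ m, w m ∈ MulAction.stabilizer G (φ m))
    (p : CosetBundle φ) : CosetBundle φ :=
  ⟨(p.1.1, w p.1.1 * p.1.2), by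
    have h : w p.1.1 • φ p.1.1 = φ p.1.1 := hw p.1.1
    rw [p.2] at h
    rw [p.2]
    exact h.symm⟩

end CosetBundle

open CosetBundle

variable {φ : M → G ⧸ H}
  {EP : Type*} [NormedAddCommGroup EP] [NormedSpace ℝ EP] [ChartedSpace EP (CosetBundle φ)]

variable (E EM EP φ) in
/-- The smooth structure on `φ^* G` is the standard one: it is an embedded submanifold
of `M × G` (this determines the smooth structure). -/
abbrev IsSubmanifoldStructure : Prop :=
  Manifold.IsSmoothEmbedding 𝓘(ℝ, EP) (𝓘(ℝ, EM).prod 𝓘(ℝ, E)) ∞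
    (Subtype.val : CosetBundle φ → M × G)

/-- Smooth connection forms on the principal `H`-bundle `φ^* G`: `𝔥`-valued `1`-forms that
reproduce the generators of the fundamental vertical vector fields `(0, g ξ)`, `ξ ∈ 𝔥`, and
satisfy `R_h^* B = Ad_*(h⁻¹) B`. -/
structure IsConnection (B : DForm EP (CosetBundle φ) E 1) : Prop where
  smooth : B.IsSmooth
  mem_lie : ∀ p X, B p ![X] ∈ subgroupLie (E := E) H
  vertical : ∀ (p : CosetBundle φ) (X : TangentSpace 𝓘(ℝ, EP) p)
    (ξ : GroupLieAlgebra 𝓘(ℝ, E) G), ξ ∈ subgroupLie (E := E) H →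
    mfderiv 𝓘(ℝ, EP) 𝓘(ℝ, EM) (π₁ : CosetBundle φ → M) p X = 0 →
    mfderiv 𝓘(ℝ, EP) 𝓘(ℝ, E) (π₂ : CosetBundle φ → G) p X = mulInvariantVectorField ξ (π₂ p) →
    B p ![X] = ξ
  equivariant : ∀ h : H, B.pullback (rightMul h) = B.mapCoeff (fun _ => Ad E (h : G)⁻¹)

/-- The transformed connection `f_w^* B`. -/
def gaugeTransform (w : M → G) (hw : ∀ m, w m ∈ MulAction.stabilizer G (φ m))
    (B : DForm EP (CosetBundle φ) E 1) : DForm EP (CosetBundle φ) E 1 :=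
  B.pullback (gaugeMap w hw)

/-- The form `g⁻¹ dg` on `φ^* G`. -/
def trivialForm : DForm EP (CosetBundle φ) E 1 :=
  (maurerCartan E G).pullback (π₂ : CosetBundle φ → G)

/-- `b` is the untwisted gauge potential of `B`: a smooth `𝔤`-valued `1`-form on `M` with
`Ad_*(g) (B - pr_𝔥 (g⁻¹ dg)) = π₁^* b`. -/
structure IsPotential (met : Metric E G) (B : DForm EP (CosetBundle φ) E 1)
    (b : DForm EM M E 1) : Prop where
  smooth : b.IsSmooth
  eq : (B - (trivialForm (G := G)).mapCoeff (fun _ => prPar met (subgroupLie H))).mapCoeff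
    (fun p => Ad E (π₂ p)) = b.pullback (π₁ : CosetBundle φ → M)

/-- The pointwise bracket `[β, γ]` of `𝔤`-valued `1`-forms. -/
def DForm.bracket (G : Type*) [TopologicalSpace G] [ChartedSpace E G] [Group G]
    [LieGroup 𝓘(ℝ, E) ∞ G] (β γ : DForm EM M E 1) : DForm EM M E 2 := fun m =>
  bracketForm (F := EM) G (β m) (γ m)

/-- `β ∧ β` for a `𝔤`-valued `1`-form `β`. -/
def DForm.wedgeSelf (G : Type*) [TopologicalSpace G] [ChartedSpace E G] [Group G]
    [LieGroup 𝓘(ℝ, E) ∞ G] (β : DForm EM M E 1) : DForm EM M E 2 := fun m =>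
  CosetGauge.wedgeSelf (F := EM) G (β m)

/-- The curvature `F(B) = dB + B ∧ B`. -/
def curvature (B : DForm EP (CosetBundle φ) E 1) : DForm EP (CosetBundle φ) E 2 :=
  B.d + B.wedgeSelf G

/-- `R` is the curvature potential `F(b)`, where `b` is the potential of `B`: a smooth `𝔤`-valued
`2`-form on `M` with `π₁^* F(b) = Ad_*(g) F(B)`. -/
structure IsCurvaturePotential (B : DForm EP (CosetBundle φ) E 1) (R : DForm EM M E 2) :
    Prop where
  smooth : R.IsSmooth
  eq : (curvature B).mapCoeff (fun p => Ad E (π₂ p)) = R.pullback (π₁ : CosetBundle φ → M)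

/-- The isotropic part `r^∥ = pr_{𝔥_φ} r` of a `𝔤`-valued form on `M`. -/
def isotropicPart {k : ℕ} (met : Metric E G) (φ : M → G ⧸ H) (r : DForm EM M E k) :
    DForm EM M E k :=
  r.mapCoeff (fun m => prPar met (isotropyLie H (φ m)))

end CosetBundle

end CosetGauge

end

open CosetGauge

/-! All three identities are verified on the bundle `φ^*G`, where `g = π₂` is an honest `G`-valued
map. Write θ = g⁻¹dg, η = pr_𝔥 θ, p = pr_{𝔥^⊥} θ. The definition of b reads B = Ad(g⁻¹) π₁^*b + η
(`potential_eq_iff`), and φ ∘ π₁ = π ∘ π₂ gives π₁^*φ^*ω^⊥ = Ad(g) p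
(`coisotropyForm_pullback_apply`). Because π₁ has smooth local sections, a form on M is determined
by its pullback to `φ^*G`, and is smooth once that pullback is. Each claim thus becomes a pointwise
identity upstairs, and uniqueness and smoothness of the potential come for free (`isPotential_iff`,
`isCurvaturePotential_iff`).

(i) The gauge map multiplies g by w on the left, equivalently by the H-valued map κ = g⁻¹wg on the
right. The first description turns θ into θ + Ad(g⁻¹) w⁻¹dw. The second shows that the 𝔥^⊥-part of
the new form is Ad(κ⁻¹) p, since κ⁻¹dκ lies in 𝔥 (`prPerp_gauge`). Subtracting this part leaves the
new 𝔥-part, and the difference between Ad(κ⁻¹) p and p is the coisotropy correction.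

(ii) Curvature is natural under pullback, and passing from g to wg inserts Ad(w⁻¹).

(iii) Differentiate B = Ad(g⁻¹) π₁^*b + η using dθ = -θ∧θ and the derivative of Ad(g⁻¹). The
inclusions [𝔥,𝔥] ⊂ 𝔥 and [𝔥,𝔥^⊥] ⊂ 𝔥^⊥ reduce pr_𝔥(θ∧θ) to η∧η + pr_𝔥(p∧p). Every term containing η
then cancels against B∧B.

The Lie-theoretic input all flows from the Maurer-Cartan equation for logarithmic derivatives
(`fderiv_logDeriv`). Applied to c(t)u(y) it gives the derivative of Ad (`contDiffAt_Ad_inv_apply`);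
applied to u and ug⁻¹ it shows that Ad(g) preserves brackets (`Ad_bracketL`). Differentiating Ad
along curves in H gives the two inclusions (`map_bracketL_eq_zero`). The calculus of forms rests on
the chart independence of d (`DForm.extDeriv_along`). -/

noncomputable section

namespace CosetGauge

/-! ### Derivatives of maps between manifolds, as maps between the model spaces -/

section TDeriv

variable (E : Type*) [NormedAddCommGroup E] [NormedSpace ℝ E]
  (E' : Type*) [NormedAddCommGroup E'] [NormedSpace ℝ E']
  (E'' : Type*) [NormedAddCommGroup E''] [NormedSpace ℝ E'']
  {M : Type*} [TopologicalSpace M] [ChartedSpace E M]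
  {M' : Type*} [TopologicalSpace M'] [ChartedSpace E' M']
  {M'' : Type*} [TopologicalSpace M''] [ChartedSpace E'' M'']

/-- The manifold derivative, as a linear map between the model spaces. -/
def tderiv (f : M → M') (x : M) : E →L[ℝ] E' := mfderiv 𝓘(ℝ, E) 𝓘(ℝ, E') f x

theorem tderiv_comp {g : M' → M''} {f : M → M'} {x : M}
    (hg : MDifferentiableAt 𝓘(ℝ, E') 𝓘(ℝ, E'') g (f x))
    (hf : MDifferentiableAt 𝓘(ℝ, E) 𝓘(ℝ, E') f x) :
    tderiv E E'' (fun y => g (f y)) x = tderiv E' E'' g (f x) ∘L tderiv E E' f x :=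
  mfderiv_comp x hg hf

theorem tderiv_eq_fderiv (f : E → E') (x : E) : tderiv E E' f x = fderiv ℝ f x :=
  mfderiv_eq_fderiv

theorem tderiv_congr {f g : M → M'} {x : M} (h : f =ᶠ[𝓝 x] g) :
    tderiv E E' f x = tderiv E E' g x :=
  h.mfderiv_eq

theorem tderiv_id (x : M) : tderiv E E (fun y : M => y) x = .id ℝ E := mfderiv_id

theorem tderiv_const (c : M') (x : M) : tderiv E E' (fun _ : M => c) x = 0 :=
  mfderiv_const

theorem contMDiffAt_chart_symm [IsManifold 𝓘(ℝ, E) ∞ M] {p : M} {x : E}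
    (hx : x ∈ (extChartAt 𝓘(ℝ, E) p).target) :
    ContMDiffAt 𝓘(ℝ, E) 𝓘(ℝ, E) ∞ (extChartAt 𝓘(ℝ, E) p).symm x :=
  (contMDiffOn_extChartAt_symm p).contMDiffAt ((isOpen_extChartAt_target p).mem_nhds hx)

theorem contMDiffAt_chart [IsManifold 𝓘(ℝ, E) ∞ M] {p y : M}
    (hy : y ∈ (extChartAt 𝓘(ℝ, E) p).source) :
    ContMDiffAt 𝓘(ℝ, E) 𝓘(ℝ, E) ∞ (extChartAt 𝓘(ℝ, E) p) y :=
  contMDiffAt_extChartAt' (by simpa using hy)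

/-- The tangent space at p is identified with the model space through the preferred chart at p, so
at its own base point that chart has identity derivative. At other points of the chart domain the
derivative is a coordinate change. -/
theorem tderiv_chart_symm_self (p : M) [IsManifold 𝓘(ℝ, E) ∞ M] :
    tderiv E E (extChartAt 𝓘(ℝ, E) p).symm (extChartAt 𝓘(ℝ, E) p p) = .id ℝ E := by
  have : IsManifold 𝓘(ℝ, E) 1 M := IsManifold.of_le (n := ∞) (by simp)
  have h := mfderivWithin_range_extChartAt_symm (I := 𝓘(ℝ, E)) (x := p)
  rw [ModelWithCorners.range_eq_univ, mfderivWithin_univ] at h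
  exact h

theorem tderiv_chart_self (p : M) [IsManifold 𝓘(ℝ, E) ∞ M] :
    tderiv E E (extChartAt 𝓘(ℝ, E) p) p = .id ℝ E := by
  have : IsManifold 𝓘(ℝ, E) 1 M := IsManifold.of_le (n := ∞) (by simp)
  exact mfderiv_extChartAt_self

end TDeriv

/-! ### Pulling forms back to vector spaces -/

section PullbackToSpace

variable {E : Type*} [NormedAddCommGroup E] [NormedSpace ℝ E]
  {M : Type*} [TopologicalSpace M] [ChartedSpace E M]
  {E' : Type*} [NormedAddCommGroup E'] [NormedSpace ℝ E']
  {M' : Type*} [TopologicalSpace M'] [ChartedSpace E' M']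
  {F : Type*} [NormedAddCommGroup F] [NormedSpace ℝ F]
  {V : Type*} [NormedAddCommGroup V] [NormedSpace ℝ V] {k : ℕ}

/-- The value of a form at a point, as an alternating map on the model space. -/
def DForm.val (α : DForm E M V k) (p : M) : E [⋀^Fin k]→L[ℝ] V := α p

theorem DForm.ext_val {α β : DForm E M V k} (h : ∀ p, α.val p = β.val p) : α = β := funext h

/-- The pullback of a form along a map from a vector space. -/
def DForm.along (α : DForm E M V k) (q : F → M) (x : F) : F [⋀^Fin k]→L[ℝ] V :=
  (α.val (q x)).compContinuousLinearMap (tderiv F E q x)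

theorem DForm.inChart_eq_along (α : DForm E M V k) (p : M) :
    α.inChart p = α.along (extChartAt 𝓘(ℝ, E) p).symm := rfl

theorem DForm.val_pullback (f : M → M') (α : DForm E' M' V k) (p : M) :
    (α.pullback f : DForm E M V k).val p =
      (α.val (f p)).compContinuousLinearMap (tderiv E E' f p) := rfl

theorem DForm.val_d (α : DForm E M V k) (p : M) [IsManifold 𝓘(ℝ, E) ∞ M] :
    α.d.val p = extDeriv (α.inChart p) (extChartAt 𝓘(ℝ, E) p p) := by
  have h : α.d.val p = (extDeriv (α.inChart p)
    (extChartAt 𝓘(ℝ, E) p p)).compContinuousLinearMap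
      (tderiv E E (extChartAt 𝓘(ℝ, E) p) p) := rfl
  rw [h, tderiv_chart_self]
  ext v
  simp

theorem DForm.along_congr (α : DForm E M V k) {q r : F → M} {x : F} (h : q =ᶠ[𝓝 x] r) :
    α.along q =ᶠ[𝓝 x] α.along r := by
  filter_upwards [h.eventuallyEq_nhds] with y hy
  simp only [DForm.along]
  rw [hy.eq_of_nhds, tderiv_congr F E hy]

theorem DForm.along_comp (α : DForm E M V k) {q : F → M} {F' : Type*} [NormedAddCommGroup F']
    [NormedSpace ℝ F'] {u : F' → F} {x : F'}
    (hq : MDifferentiableAt 𝓘(ℝ, F) 𝓘(ℝ, E) q (u x)) (hu : DifferentiableAt ℝ u x) :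
    α.along (fun y => q (u y)) x = (α.along q (u x)).compContinuousLinearMap (fderiv ℝ u x) := by
  simp only [DForm.along]
  rw [tderiv_comp F' F E hq hu.mdifferentiableAt, tderiv_eq_fderiv]
  rfl

theorem DForm.along_pullback (α : DForm E' M' V k) {f : M → M'} {q : F → M} {x : F}
    (hf : MDifferentiableAt 𝓘(ℝ, E) 𝓘(ℝ, E') f (q x))
    (hq : MDifferentiableAt 𝓘(ℝ, F) 𝓘(ℝ, E) q x) :
    (α.pullback f : DForm E M V k).along q x = α.along (fun y => f (q y)) x := by
  simp only [DForm.along, DForm.val_pullback]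
  rw [tderiv_comp F E E' hf hq]
  rfl

/-- Smoothness of a form at a point, in terms of the preferred chart at that point. -/
def DForm.IsSmoothAt (α : DForm E M V k) (p : M) : Prop :=
  ContDiffAt ℝ ∞ (α.inChart p) (extChartAt 𝓘(ℝ, E) p p)

theorem DForm.IsSmooth.isSmoothAt {α : DForm E M V k} (h : α.IsSmooth) (p : M) :
    α.IsSmoothAt p :=
  (h p).contDiffAt ((isOpen_extChartAt_target p).mem_nhds (mem_extChartAt_target p))

variable [IsManifold 𝓘(ℝ, E) ∞ M]

theorem DForm.IsSmoothAt.congr {α β : DForm E M V k} {p : M} (hα : α.IsSmoothAt p)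
    (h : ∀ᶠ y in 𝓝 p, β.val y = α.val y) : β.IsSmoothAt p := by
  refine ContDiffAt.congr_of_eventuallyEq hα ?_
  have hs := (contMDiffAt_chart_symm E (mem_extChartAt_target (I := 𝓘(ℝ, E)) p)).continuousAt
  have h' : ∀ᶠ y in 𝓝 ((extChartAt 𝓘(ℝ, E) p).symm (extChartAt 𝓘(ℝ, E) p p)),
      β.val y = α.val y := by rwa [extChartAt_to_inv]
  filter_upwards [hs.eventually h'] with x hx
  rw [DForm.inChart_eq_along, DForm.inChart_eq_along, DForm.along, DForm.along, hx]

omit [NormedSpace ℝ F] [IsManifold 𝓘(ℝ, E) ∞ M] in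
theorem eventuallyEq_chart_symm {q : F → M} {x : F} (hq : ContinuousAt q x) :
    q =ᶠ[𝓝 x] fun y =>
      (extChartAt 𝓘(ℝ, E) (q x)).symm (extChartAt 𝓘(ℝ, E) (q x) (q y)) := by
  filter_upwards [hq.eventually (extChartAt_source_mem_nhds (I := 𝓘(ℝ, E)) (q x))] with y hy
  exact ((extChartAt 𝓘(ℝ, E) (q x)).left_inv hy).symm

theorem contDiffAt_chart_comp {q : F → M} {x : F} (hq : ContMDiffAt 𝓘(ℝ, F) 𝓘(ℝ, E) ∞ q x) :
    ContDiffAt ℝ ∞ (fun y => extChartAt 𝓘(ℝ, E) (q x) (q y)) x :=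
  (ContMDiffAt.comp x (I' := 𝓘(ℝ, E)) (f := q)
    (contMDiffAt_chart E (p := q x) (mem_extChartAt_source (I := 𝓘(ℝ, E)) (q x))) hq).contDiffAt

/-- Factor q through the chart at q x. Near x the pullback along q becomes the pullback of a form on
a vector space by a map of vector spaces, so smoothness and exterior derivatives reduce to ordinary
calculus. -/
theorem DForm.along_eventuallyEq_inChart (α : DForm E M V k) {q : F → M} {x : F}
    (hq : ContMDiffAt 𝓘(ℝ, F) 𝓘(ℝ, E) ∞ q x) :
    α.along q =ᶠ[𝓝 x] fun y =>
      (α.inChart (q x) (extChartAt 𝓘(ℝ, E) (q x) (q y))).compContinuousLinearMap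
        (fderiv ℝ (fun y => extChartAt 𝓘(ℝ, E) (q x) (q y)) y) := by
  refine (α.along_congr (eventuallyEq_chart_symm (E := E) hq.continuousAt)).trans ?_
  have hu := contDiffAt_chart_comp hq
  -- Being C^n at a point spreads to a neighbourhood for finite n; order 1 is all that is needed
  -- here.
  have hu' : ∀ᶠ y in 𝓝 x, ContDiffAt ℝ 1 (fun y => extChartAt 𝓘(ℝ, E) (q x) (q y)) y :=
    (hu.of_le (by simp)).eventually (by simp)
  have ht : ∀ᶠ y in 𝓝 x, extChartAt 𝓘(ℝ, E) (q x) (q y) ∈ (extChartAt 𝓘(ℝ, E) (q x)).target :=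
    hu.continuousAt.eventually ((isOpen_extChartAt_target (q x)).mem_nhds (mem_extChartAt_target _))
  filter_upwards [hu', ht] with y hy hty
  exact α.along_comp ((contMDiffAt_chart_symm E hty).mdifferentiableAt (by simp))
    (hy.differentiableAt (by simp))

/-- Alternatization of continuous multilinear maps, as a continuous linear map. -/
def alternatizationCLM (E V : Type*) [NormedAddCommGroup E] [NormedSpace ℝ E]
    [NormedAddCommGroup V] [NormedSpace ℝ V] (k : ℕ) :
    ContinuousMultilinearMap ℝ (fun _ : Fin k => E) V →L[ℝ] E [⋀^Fin k]→L[ℝ] V :=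
  LinearMap.mkContinuous
    { toFun := ContinuousMultilinearMap.alternatization
      map_add' := map_add _
      map_smul' := fun c f => by
        ext v
        simp only [ContinuousMultilinearMap.alternatization_apply_apply, Finset.smul_sum,
          smul_apply, ContinuousAlternatingMap.smul_apply,
          RingHom.id_apply]
        exact Finset.sum_congr rfl fun σ _ => smul_comm _ _ _ }
    (Fintype.card (Equiv.Perm (Fin k))) fun f => by
      refine ContinuousAlternatingMap.opNorm_le_bound _ (by positivity) fun v => ?_
      simp only [LinearMap.coe_mk, AddHom.coe_mk,
        ContinuousMultilinearMap.alternatization_apply_apply]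
      refine (norm_sum_le _ _).trans ?_
      refine (Finset.sum_le_card_nsmul _ _ (‖f‖ * ∏ i, ‖v i‖) fun σ _ => ?_).trans_eq ?_
      · have h1 : ‖Equiv.Perm.sign σ • f (v ∘ σ)‖ = ‖f (v ∘ σ)‖ := by
          rcases Int.units_eq_one_or (Equiv.Perm.sign σ) with h | h <;> simp [h]
        rw [h1]
        refine (f.le_opNorm _).trans_eq ?_
        simp only [Function.comp_apply]
        rw [Equiv.prod_comp σ fun i => ‖v i‖]
      · simp [mul_assoc]

/-- Each of the k! permutations contributes the same term. After division by k!, alternatization is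
a continuous linear left inverse of the inclusion of alternating maps into multilinear maps. -/
theorem alternatizationCLM_toContinuousMultilinearMap (a : E [⋀^Fin k]→L[ℝ] V) :
    alternatizationCLM E V k a.toContinuousMultilinearMap =
      (Fintype.card (Equiv.Perm (Fin k)) : ℝ) • a := by
  ext v
  have h : ∀ σ : Equiv.Perm (Fin k), Equiv.Perm.sign σ • a (v ∘ σ) = a v := fun σ => by
    rw [show a (v ∘ σ) = Equiv.Perm.sign σ • a v from a.toAlternatingMap.map_perm v σ,
      smul_smul, Int.units_mul_self, one_smul]
  simp [alternatizationCLM, ContinuousMultilinearMap.alternatization_apply_apply, h,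
    Nat.cast_smul_eq_nsmul]

/-- Alternating maps are a continuous linear retract of multilinear maps. This transfers to them the
smoothness of precomposition by a varying linear map, which is itself multilinear in that map. -/
theorem contDiffAt_alternating_iff {a : F → E [⋀^Fin k]→L[ℝ] V} {x : F} {n : WithTop ℕ∞} :
    ContDiffAt ℝ n a x ↔ ContDiffAt ℝ n (fun y => (a y).toContinuousMultilinearMap) x := by
  refine ⟨fun h => (ContinuousAlternatingMap.toContinuousMultilinearMapCLM ℝ :
    (E [⋀^Fin k]→L[ℝ] V) →L[ℝ] _).contDiff.contDiffAt.comp x h, fun h => ?_⟩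
  have h2 := ((alternatizationCLM E V k).contDiff.contDiffAt.comp x h).const_smul
    ((Fintype.card (Equiv.Perm (Fin k)) : ℝ)⁻¹)
  refine h2.congr_of_eventuallyEq (Filter.Eventually.of_forall fun y => ?_)
  simp only [Function.comp_apply, alternatizationCLM_toContinuousMultilinearMap]
  rw [smul_smul, inv_mul_cancel₀ (by simp), one_smul]

theorem ContDiffAt.compContinuousLinearMap {F' : Type*} [NormedAddCommGroup F']
    [NormedSpace ℝ F'] {a : F → E [⋀^Fin k]→L[ℝ] V} {L : F → F' →L[ℝ] E} {x : F} {n : WithTop ℕ∞}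
    (ha : ContDiffAt ℝ n a x) (hL : ContDiffAt ℝ n L x) :
    ContDiffAt ℝ n (fun y => (a y).compContinuousLinearMap (L y)) x := by
  rw [contDiffAt_alternating_iff] at ha ⊢
  have h := (ContinuousMultilinearMap.compContinuousLinearMapContinuousMultilinear ℝ
    (fun _ : Fin k => F') (fun _ : Fin k => E) V).contDiff (n := n)
  have h1 : ContDiffAt ℝ n (fun y => fun _ : Fin k => L y) x := contDiffAt_pi.2 fun _ => hL
  exact (h.contDiffAt.comp x h1).clm_apply ha

theorem DForm.IsSmoothAt.along {α : DForm E M V k} {q : F → M} {x : F}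
    (hα : α.IsSmoothAt (q x)) (hq : ContMDiffAt 𝓘(ℝ, F) 𝓘(ℝ, E) ∞ q x) :
    ContDiffAt ℝ ∞ (α.along q) x := by
  refine ContDiffAt.congr_of_eventuallyEq ?_ (α.along_eventuallyEq_inChart hq)
  have hu := contDiffAt_chart_comp hq
  exact ContDiffAt.compContinuousLinearMap
    (ContDiffAt.comp x (f := fun y => extChartAt 𝓘(ℝ, E) (q x) (q y)) hα hu)
    (hu.fderiv_right (by simp))

/-- This is the chart independence of d. `DForm.d` uses a different chart at each point, but
naturality of `extDeriv` under maps of vector spaces makes the choices agree, because the chart at q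
x has identity derivative there. -/
theorem DForm.extDeriv_along {α : DForm E M V k} {q : F → M} {x : F}
    (hα : α.IsSmoothAt (q x)) (hq : ContMDiffAt 𝓘(ℝ, F) 𝓘(ℝ, E) ∞ q x) :
    extDeriv (α.along q) x = α.d.along q x := by
  have hu := contDiffAt_chart_comp hq
  rw [(α.along_eventuallyEq_inChart hq).extDeriv_eq,
    extDeriv_pullback (f := fun y => extChartAt 𝓘(ℝ, E) (q x) (q y))
      (ContDiffAt.differentiableAt hα (by simp)) hu
      (by rw [minSmoothness_of_isRCLikeNormedField]; exact ENat.LEInfty.out)]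
  simp only [DForm.along, DForm.val_d]
  congr 1
  rw [tderiv_congr F E (eventuallyEq_chart_symm (E := E) hq.continuousAt),
    tderiv_comp F E E (f := fun y => extChartAt 𝓘(ℝ, E) (q x) (q y)) ((contMDiffAt_chart_symm E (mem_extChartAt_target (I := 𝓘(ℝ, E)) (q x))).mdifferentiableAt
      (by simp)) (hu.differentiableAt (by simp)).mdifferentiableAt, tderiv_chart_symm_self,
      tderiv_eq_fderiv]
  rfl

/-- Smoothness on a whole chart domain follows from smoothness at the centre of the preferred chart
of each point, by pulling back along the inverse chart. -/
theorem DForm.isSmooth_of_isSmoothAt {α : DForm E M V k} (h : ∀ p, α.IsSmoothAt p) :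
    α.IsSmooth := fun _ _ hx =>
  ((h _).along (contMDiffAt_chart_symm E hx)).contDiffWithinAt

end PullbackToSpace

/-! ### Operations on forms on manifolds -/

section FormOperations

variable {E : Type*} [NormedAddCommGroup E] [NormedSpace ℝ E]
  {M : Type*} [TopologicalSpace M] [ChartedSpace E M]
  {E' : Type*} [NormedAddCommGroup E'] [NormedSpace ℝ E']
  {M' : Type*} [TopologicalSpace M'] [ChartedSpace E' M']
  {F : Type*} [NormedAddCommGroup F] [NormedSpace ℝ F]
  {V : Type*} [NormedAddCommGroup V] [NormedSpace ℝ V] {k : ℕ}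

/-- Smoothness of finite order at a point persists nearby, so the order is first lowered to 1. -/
theorem ContMDiffAt.eventually_mdifferentiableAt [IsManifold 𝓘(ℝ, E) ∞ M]
    [IsManifold 𝓘(ℝ, E') ∞ M'] {f : M → M'} {p : M}
    (hf : ContMDiffAt 𝓘(ℝ, E) 𝓘(ℝ, E') ∞ f p) :
    ∀ᶠ y in 𝓝 p, MDifferentiableAt 𝓘(ℝ, E) 𝓘(ℝ, E') f y := by
  have : IsManifold 𝓘(ℝ, E) 1 M := IsManifold.of_le (n := ∞) (by simp)
  have : IsManifold 𝓘(ℝ, E') 1 M' := IsManifold.of_le (n := ∞) (by simp)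
  filter_upwards [(contMDiffAt_iff_contMDiffAt_nhds (n := 1) (by simp)).1
    (hf.of_le (by simp))] with y hy
  exact hy.mdifferentiableAt (by simp)

theorem ContMDiffAt.comp_chart_symm [IsManifold 𝓘(ℝ, E) ∞ M] {f : M → M'} {p : M}
    (hf : ContMDiffAt 𝓘(ℝ, E) 𝓘(ℝ, E') ∞ f p) :
    ContMDiffAt 𝓘(ℝ, E) 𝓘(ℝ, E') ∞ (fun x => f ((extChartAt 𝓘(ℝ, E) p).symm x))
      (extChartAt 𝓘(ℝ, E) p p) := by
  refine ContMDiffAt.comp (I' := 𝓘(ℝ, E)) (g := f) _ ?_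
    (contMDiffAt_chart_symm E (mem_extChartAt_target p))
  rwa [extChartAt_to_inv]

theorem DForm.inChart_pullback_eventuallyEq [IsManifold 𝓘(ℝ, E) ∞ M]
    [IsManifold 𝓘(ℝ, E') ∞ M'] (α : DForm E' M' V k) {f : M → M'} {p : M}
    (hf : ContMDiffAt 𝓘(ℝ, E) 𝓘(ℝ, E') ∞ f p) :
    (α.pullback f : DForm E M V k).inChart p =ᶠ[𝓝 (extChartAt 𝓘(ℝ, E) p p)]
      α.along (fun x => f ((extChartAt 𝓘(ℝ, E) p).symm x)) := by
  have h1 : ∀ᶠ x in 𝓝 (extChartAt 𝓘(ℝ, E) p p),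
      MDifferentiableAt 𝓘(ℝ, E) 𝓘(ℝ, E') f ((extChartAt 𝓘(ℝ, E) p).symm x) := by
    refine (contMDiffAt_chart_symm E
      (mem_extChartAt_target (I := 𝓘(ℝ, E)) p)).continuousAt.eventually ?_
    rw [extChartAt_to_inv]
    exact ContMDiffAt.eventually_mdifferentiableAt hf
  filter_upwards [h1, (isOpen_extChartAt_target (I := 𝓘(ℝ, E)) p).mem_nhds
    (mem_extChartAt_target p)] with x hx hxt
  rw [DForm.inChart_eq_along]
  exact α.along_pullback hx ((contMDiffAt_chart_symm E hxt).mdifferentiableAt (by simp))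

theorem DForm.IsSmoothAt.pullback [IsManifold 𝓘(ℝ, E) ∞ M] [IsManifold 𝓘(ℝ, E') ∞ M']
    {α : DForm E' M' V k} {f : M → M'} {p : M} (hα : α.IsSmoothAt (f p))
    (hf : ContMDiffAt 𝓘(ℝ, E) 𝓘(ℝ, E') ∞ f p) :
    (α.pullback f : DForm E M V k).IsSmoothAt p := by
  refine ContDiffAt.congr_of_eventuallyEq ?_ (α.inChart_pullback_eventuallyEq hf)
  refine DForm.IsSmoothAt.along ?_ (ContMDiffAt.comp_chart_symm hf)
  rwa [extChartAt_to_inv]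

theorem DForm.IsSmooth.pullback [IsManifold 𝓘(ℝ, E) ∞ M] [IsManifold 𝓘(ℝ, E') ∞ M']
    {α : DForm E' M' V k} {f : M → M'} (hα : α.IsSmooth)
    (hf : ContMDiff 𝓘(ℝ, E) 𝓘(ℝ, E') ∞ f) :
    (α.pullback f : DForm E M V k).IsSmooth :=
  DForm.isSmooth_of_isSmoothAt fun p => (hα.isSmoothAt (f p)).pullback (hf p)

/-- Read in the chart at p, both sides are the exterior derivative of α along the composite of f
with the inverse chart. -/
theorem DForm.d_pullback [IsManifold 𝓘(ℝ, E) ∞ M] [IsManifold 𝓘(ℝ, E') ∞ M']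
    {α : DForm E' M' V k} {f : M → M'} (hα : α.IsSmooth)
    (hf : ContMDiff 𝓘(ℝ, E) 𝓘(ℝ, E') ∞ f) :
    (α.pullback f : DForm E M V k).d = α.d.pullback f := by
  refine DForm.ext_val fun p => ?_
  rw [DForm.val_d, (α.inChart_pullback_eventuallyEq (hf p)).extDeriv_eq,
    DForm.extDeriv_along (hα.isSmoothAt _) (ContMDiffAt.comp_chart_symm (hf p)),
    DForm.val_pullback, DForm.along,
    tderiv_comp E E E' (hf.mdifferentiableAt (by simp))
      ((contMDiffAt_chart_symm E (mem_extChartAt_target p)).mdifferentiableAt (by simp)),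
    tderiv_chart_symm_self, extChartAt_to_inv]
  rfl

theorem DForm.inChart_d_eventuallyEq [IsManifold 𝓘(ℝ, E) ∞ M] {α : DForm E M V k}
    (hα : α.IsSmooth) (p : M) :
    α.d.inChart p =ᶠ[𝓝 (extChartAt 𝓘(ℝ, E) p p)] extDeriv (α.inChart p) := by
  filter_upwards [(isOpen_extChartAt_target (I := 𝓘(ℝ, E)) p).mem_nhds
    (mem_extChartAt_target p)] with x hx
  rw [DForm.inChart_eq_along, DForm.inChart_eq_along,
    DForm.extDeriv_along (hα.isSmoothAt _) (contMDiffAt_chart_symm E hx)]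

theorem DForm.IsSmooth.d [IsManifold 𝓘(ℝ, E) ∞ M] {α : DForm E M V k} (hα : α.IsSmooth) :
    α.d.IsSmooth := by
  refine DForm.isSmooth_of_isSmoothAt fun p => ?_
  refine ContDiffAt.congr_of_eventuallyEq ?_ (DForm.inChart_d_eventuallyEq hα p)
  have h : ContDiffAt ℝ ∞ (fderiv ℝ (α.inChart p)) (extChartAt 𝓘(ℝ, E) p p) :=
    ContDiffAt.fderiv_right (hα.isSmoothAt p) (by simp)
  exact (ContinuousAlternatingMap.alternatizeUncurryFinCLM ℝ E V).contDiff.contDiffAt.comp _ h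

variable [IsManifold 𝓘(ℝ, E) ∞ M]

theorem DForm.IsSmooth.add {α β : DForm E M V k} (hα : α.IsSmooth) (hβ : β.IsSmooth) :
    (α + β).IsSmooth :=
  DForm.isSmooth_of_isSmoothAt fun p =>
    ContDiffAt.add (hα.isSmoothAt p) (hβ.isSmoothAt p)

theorem DForm.IsSmooth.sub {α β : DForm E M V k} (hα : α.IsSmooth) (hβ : β.IsSmooth) :
    (α - β).IsSmooth :=
  DForm.isSmooth_of_isSmoothAt fun p =>
    ContDiffAt.sub (hα.isSmoothAt p) (hβ.isSmoothAt p)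

theorem DForm.IsSmooth.mapCoeff {α : DForm E M V k} {L : M → V →L[ℝ] V} (hα : α.IsSmooth)
    (hL : ContMDiff 𝓘(ℝ, E) 𝓘(ℝ, V →L[ℝ] V) ∞ L) : (α.mapCoeff L).IsSmooth :=
  DForm.isSmooth_of_isSmoothAt fun p => by
    have h : ContDiffAt ℝ ∞ (fun x => L ((extChartAt 𝓘(ℝ, E) p).symm x))
        (extChartAt 𝓘(ℝ, E) p p) := (ContMDiffAt.comp_chart_symm (hL p)).contDiffAt
    exact ((ContinuousLinearMap.compContinuousAlternatingMapCLM ℝ E V V (Fin k)).contDiff.contDiffAt.comp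
      _ h).clm_apply (hα.isSmoothAt p)

end FormOperations

/-! ### Lie algebra valued forms: evaluation on vectors, naturality and smoothness of `wedgeSelf` -/

section BracketForms

variable {E : Type*} [NormedAddCommGroup E] [NormedSpace ℝ E] [FiniteDimensional ℝ E]
  {G : Type*} [TopologicalSpace G] [ChartedSpace E G] [Group G] [LieGroup 𝓘(ℝ, E) ∞ G]
  {EM : Type*} [NormedAddCommGroup EM] [NormedSpace ℝ EM]
  {M : Type*} [TopologicalSpace M] [ChartedSpace EM M]
  {EN : Type*} [NormedAddCommGroup EN] [NormedSpace ℝ EN]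
  {N : Type*} [TopologicalSpace N] [ChartedSpace EN N]
  {F : Type*} [NormedAddCommGroup F] [NormedSpace ℝ F]

theorem alternating_two_ext {V : Type*} [NormedAddCommGroup V] [NormedSpace ℝ V]
    {a b : F [⋀^Fin 2]→L[ℝ] V} (h : ∀ X Y, a ![X, Y] = b ![X, Y]) : a = b := by
  ext v
  rw [show v = ![v 0, v 1] by ext i; fin_cases i <;> rfl]
  exact h _ _

theorem alternating_one_ext {V : Type*} [NormedAddCommGroup V] [NormedSpace ℝ V]
    {a b : F [⋀^Fin 1]→L[ℝ] V} (h : ∀ X, a ![X] = b ![X]) : a = b := by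
  ext v
  rw [show v = ![v 0] by ext i; fin_cases i; rfl]
  exact h _

theorem compContinuousLinearMap_apply_one {V : Type*} [NormedAddCommGroup V] [NormedSpace ℝ V]
    {F' : Type*} [NormedAddCommGroup F'] [NormedSpace ℝ F']
    (a : F [⋀^Fin 1]→L[ℝ] V) (L : F' →L[ℝ] F) (X : F') :
    a.compContinuousLinearMap L ![X] = a ![L X] := by
  rw [ContinuousAlternatingMap.compContinuousLinearMap_apply]
  congr 1
  ext i; fin_cases i; rfl

theorem compContinuousLinearMap_apply_two {V : Type*} [NormedAddCommGroup V] [NormedSpace ℝ V]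
    {F' : Type*} [NormedAddCommGroup F'] [NormedSpace ℝ F']
    (a : F [⋀^Fin 2]→L[ℝ] V) (L : F' →L[ℝ] F) (X Y : F') :
    a.compContinuousLinearMap L ![X, Y] = a ![L X, L Y] := by
  rw [ContinuousAlternatingMap.compContinuousLinearMap_apply]
  congr 1
  ext i; fin_cases i <;> rfl

theorem wedgeSelf_compContinuousLinearMap {F' : Type*} [NormedAddCommGroup F'] [NormedSpace ℝ F']
    (a : F [⋀^Fin 1]→L[ℝ] E) (L : F' →L[ℝ] F) :
    wedgeSelf G (a.compContinuousLinearMap L) = (wedgeSelf G a).compContinuousLinearMap L := by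
  refine alternating_two_ext fun X Y => ?_
  rw [compContinuousLinearMap_apply_two, wedgeSelf_apply, wedgeSelf_apply,
    compContinuousLinearMap_apply_one, compContinuousLinearMap_apply_one]

/-- The wedge square is built from continuous linear operations: the 1-form is read as a linear map,
inserted in both slots of the bracket, and the result is alternatized. -/
theorem ContDiffAt.wedgeSelf {F' : Type*} [NormedAddCommGroup F'] [NormedSpace ℝ F']
    {a : F' → F [⋀^Fin 1]→L[ℝ] E} {x : F'} {n : WithTop ℕ∞} (ha : ContDiffAt ℝ n a x) :
    ContDiffAt ℝ n (fun y => CosetGauge.wedgeSelf G (a y)) x := by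
  have h1 : ContDiffAt ℝ n
      (fun y => (ContinuousAlternatingMap.ofSubsingleton ℝ F E (0 : Fin 1)).symm (a y)) x :=
    (ContinuousAlternatingMap.ofSubsingletonLIE (𝕜 := ℝ) (E := F) (F := E)
      (0 : Fin 1)).symm.toContinuousLinearEquiv.contDiff.contDiffAt.comp x ha
  have h2 := (contDiffAt_const (c := bracketL E G)).clm_comp h1
  have h3 := ((ContinuousLinearMap.compL ℝ F E E).flip.contDiff.contDiffAt.comp x h1).clm_comp h2
  have h4 := (contDiffAt_const (c := ((ContinuousAlternatingMap.ofSubsingletonLIE (𝕜 := ℝ)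
    (E := F) (F := E) (0 : Fin 1)).toContinuousLinearEquiv :
      (F →L[ℝ] E) →L[ℝ] F [⋀^Fin 1]→L[ℝ] E))).clm_comp h3
  exact ((ContinuousAlternatingMap.alternatizeUncurryFinCLM ℝ F E).contDiff.contDiffAt.comp x
    h4).const_smul (1 / 2 : ℝ)

theorem DForm.val_wedgeSelf (β : DForm EM M E 1) (p : M) :
    (β.wedgeSelf G).val p = CosetGauge.wedgeSelf G (β.val p) := rfl

theorem DForm.wedgeSelf_pullback (β : DForm EM M E 1) (f : N → M) :
    ((β.wedgeSelf G).pullback f : DForm EN N E 2) = DForm.wedgeSelf G (β.pullback f) := by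
  refine DForm.ext_val fun p => ?_
  rw [DForm.val_pullback, DForm.val_wedgeSelf, DForm.val_wedgeSelf, DForm.val_pullback,
    wedgeSelf_compContinuousLinearMap]

theorem DForm.IsSmooth.wedgeSelf [IsManifold 𝓘(ℝ, EM) ∞ M] {β : DForm EM M E 1}
    (hβ : β.IsSmooth) : (β.wedgeSelf G).IsSmooth :=
  DForm.isSmooth_of_isSmoothAt fun p => by
    have h : (β.wedgeSelf G).inChart p = fun x => CosetGauge.wedgeSelf G (β.inChart p x) := by
      funext x
      exact (wedgeSelf_compContinuousLinearMap (G := G) (β.val _) _).symm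
    rw [DForm.IsSmoothAt, h]
    exact ContDiffAt.wedgeSelf (hβ.isSmoothAt p)

end BracketForms

/-! ### Logarithmic derivatives of maps to a Lie group -/

section LogarithmicDerivative

variable {E : Type*} [NormedAddCommGroup E] [NormedSpace ℝ E]
  {G : Type*} [TopologicalSpace G] [ChartedSpace E G] [Group G]
  {EM : Type*} [NormedAddCommGroup EM] [NormedSpace ℝ EM]
  {M : Type*} [TopologicalSpace M] [ChartedSpace EM M]
  {EN : Type*} [NormedAddCommGroup EN] [NormedSpace ℝ EN]
  {N : Type*} [TopologicalSpace N] [ChartedSpace EN N]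
  {F : Type*} [NormedAddCommGroup F] [NormedSpace ℝ F]

variable (E EM) in
/-- The logarithmic derivative `u⁻¹ du` of a map `u : M → G`, at a point. -/
def logDeriv (u : M → G) (x : M) : EM →L[ℝ] E :=
  tderiv E E (fun g : G => (u x)⁻¹ * g) (u x) ∘L tderiv EM E u x

theorem maurerCartan_val_apply (g : G) (v : E) :
    (maurerCartan E G).val g ![v] = tderiv E E (fun h : G => g⁻¹ * h) g v := rfl

theorem maurerCartan_along_apply (u : F → G) (x v : F) :
    (maurerCartan E G).along u x ![v] = logDeriv E F u x v := rfl

theorem logDeriv_const (g : G) (x : M) : logDeriv E EM (fun _ : M => g) x = 0 := by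
  rw [logDeriv, tderiv_const, ContinuousLinearMap.comp_zero]

theorem logDeriv_comp {u : M → G} {f : N → M} {x : N}
    (hu : MDifferentiableAt 𝓘(ℝ, EM) 𝓘(ℝ, E) u (f x))
    (hf : MDifferentiableAt 𝓘(ℝ, EN) 𝓘(ℝ, EM) f x) :
    logDeriv E EN (fun y => u (f y)) x = logDeriv E EM u (f x) ∘L tderiv EN EM f x := by
  rw [logDeriv, tderiv_comp EN EM E hu hf]
  rfl

variable [LieGroup 𝓘(ℝ, E) ∞ G]

theorem mdifferentiableAt_mul_left (g h : G) :
    MDifferentiableAt 𝓘(ℝ, E) 𝓘(ℝ, E) (fun x : G => g * x) h :=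
  (contMDiff_mul_left (n := ∞)).mdifferentiableAt (by simp)

theorem mdifferentiableAt_conj (g h : G) :
    MDifferentiableAt 𝓘(ℝ, E) 𝓘(ℝ, E) (fun x : G => g * x * g⁻¹) h :=
  ((contMDiff_mul_right (n := ∞) (a := g⁻¹)).comp
    (contMDiff_mul_left (n := ∞) (a := g))).mdifferentiableAt (by simp)

theorem tderiv_mul_of_eq_one {a b : M → G} {x : M} (ha : MDifferentiableAt 𝓘(ℝ, EM) 𝓘(ℝ, E) a x)
    (hb : MDifferentiableAt 𝓘(ℝ, EM) 𝓘(ℝ, E) b x) (ha1 : a x = 1) (hb1 : b x = 1) :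
    tderiv EM E (fun y => a y * b y) x = tderiv EM E a x + tderiv EM E b x := by
  have hm : MDifferentiableAt (𝓘(ℝ, E).prod 𝓘(ℝ, E)) 𝓘(ℝ, E)
      (fun p : G × G => p.1 * p.2) (a x, b x) :=
    (contMDiff_mul 𝓘(ℝ, E) ∞).mdifferentiableAt (by simp)
  have h1 : ∀ v, (tderiv EM E (fun y => a y * b y) x) v =
      tderiv E E (fun z => z * b x) (a x) (tderiv EM E a x v) +
        tderiv E E (fun z => a x * z) (b x) (tderiv EM E b x v) := by
    intro v
    have h1 := mfderiv_comp_apply (I := 𝓘(ℝ, EM)) (f := fun t => (a t, b t)) x hm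
      (ha.prodMk hb) v
    rw [mfderiv_prodMk ha hb, mfderiv_prod_eq_add_apply hm] at h1
    exact h1
  ext v
  rw [h1, hb1, ha1]
  simp only [mul_one, one_mul, tderiv_id]
  rfl

/-- Translating first yields a map through 1, so derivatives of different maps can be compared in
the single space T₁G. -/
theorem logDeriv_eq {u : M → G} {x : M} (hu : MDifferentiableAt 𝓘(ℝ, EM) 𝓘(ℝ, E) u x) :
    logDeriv E EM u x = tderiv EM E (fun y => (u x)⁻¹ * u y) x :=
  (tderiv_comp EM E E (mdifferentiableAt_mul_left (u x)⁻¹ (u x)) hu).symm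

variable (E) in
omit [LieGroup 𝓘(ℝ, E) ∞ G] in
theorem Ad_eq_tderiv (g : G) : Ad E g = tderiv E E (fun x : G => g * x * g⁻¹) 1 := rfl

theorem MDifferentiableAt.left_mul {u : M → G} {x : M}
    (hu : MDifferentiableAt 𝓘(ℝ, EM) 𝓘(ℝ, E) u x) (g : G) :
    MDifferentiableAt 𝓘(ℝ, EM) 𝓘(ℝ, E) (fun y => g * u y) x :=
  MDifferentiableAt.comp x (g := fun z : G => g * z) (mdifferentiableAt_mul_left g (u x)) hu

theorem tderiv_conj {u : M → G} {x : M} (hu : MDifferentiableAt 𝓘(ℝ, EM) 𝓘(ℝ, E) u x)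
    (hu1 : u x = 1) (g : G) :
    tderiv EM E (fun y => g * u y * g⁻¹) x = Ad E g ∘L tderiv EM E u x := by
  rw [tderiv_comp EM E E (mdifferentiableAt_conj g (u x)) hu, hu1, Ad_eq_tderiv]

/-- The product rule comes from the factorization (a(x)b(x))⁻¹ a(y)b(y) = [b(x)⁻¹ (a(x)⁻¹a(y)) b(x)]
· [b(x)⁻¹b(y)]. Both factors equal 1 at y = x, where derivatives of products add. -/
theorem logDeriv_mul {a b : M → G} {x : M} (ha : MDifferentiableAt 𝓘(ℝ, EM) 𝓘(ℝ, E) a x)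
    (hb : MDifferentiableAt 𝓘(ℝ, EM) 𝓘(ℝ, E) b x) :
    logDeriv E EM (fun y => a y * b y) x =
      logDeriv E EM b x + Ad E (b x)⁻¹ ∘L logDeriv E EM a x := by
  have ha' := MDifferentiableAt.left_mul ha (a x)⁻¹
  have hb' := MDifferentiableAt.left_mul hb (b x)⁻¹
  have hc : MDifferentiableAt 𝓘(ℝ, EM) 𝓘(ℝ, E)
      (fun y => (b x)⁻¹ * ((a x)⁻¹ * a y) * (b x)⁻¹⁻¹) x :=
    MDifferentiableAt.comp x (g := fun z : G => (b x)⁻¹ * z * (b x)⁻¹⁻¹)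
      (mdifferentiableAt_conj _ _) ha'
  have hab : MDifferentiableAt 𝓘(ℝ, EM) 𝓘(ℝ, E) (fun y => a y * b y) x :=
    MDifferentiableAt.comp x (g := fun p : G × G => p.1 * p.2) (f := fun y => (a y, b y))
      ((contMDiff_mul 𝓘(ℝ, E) ∞).mdifferentiableAt (by simp)) (ha.prodMk hb)
  rw [logDeriv_eq hab, logDeriv_eq hb, logDeriv_eq ha, ← tderiv_conj ha' (by simp),
    add_comm, ← tderiv_mul_of_eq_one hc hb' (by simp) (by simp)]
  congr 1
  funext y
  group

omit [LieGroup 𝓘(ℝ, E) ∞ G] in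
theorem Ad_one : Ad E (1 : G) = .id ℝ E := by
  rw [Ad_eq_tderiv]
  simpa using tderiv_id E (1 : G)

theorem Ad_mul (g h : G) : Ad E (g * h) = Ad E g ∘L Ad E h := by
  rw [Ad_eq_tderiv E h, ← tderiv_conj (mdifferentiableAt_conj h 1) (by simp), Ad_eq_tderiv]
  congr 1
  funext y
  group

theorem Ad_inv_comp (g : G) : Ad E g⁻¹ ∘L Ad E g = .id ℝ E := by
  rw [← Ad_mul, inv_mul_cancel, Ad_one]

theorem Ad_comp_inv (g : G) : Ad E g ∘L Ad E g⁻¹ = .id ℝ E := by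
  rw [← Ad_mul, mul_inv_cancel, Ad_one]

theorem Ad_inv_apply (g : G) (v : E) : Ad E g⁻¹ (Ad E g v) = v :=
  DFunLike.congr_fun (Ad_inv_comp g) v

theorem Ad_apply_inv (g : G) (v : E) : Ad E g (Ad E g⁻¹ v) = v :=
  DFunLike.congr_fun (Ad_comp_inv g) v

theorem logDeriv_mul_const {u : M → G} {x : M} (hu : MDifferentiableAt 𝓘(ℝ, EM) 𝓘(ℝ, E) u x)
    (g : G) : logDeriv E EM (fun y => u y * g) x = Ad E g⁻¹ ∘L logDeriv E EM u x := by
  rw [logDeriv_mul hu mdifferentiableAt_const, logDeriv_const, zero_add]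

theorem tderiv_inv_mul_comp_mul (g : G) :
    tderiv E E (fun h : G => g⁻¹ * h) g ∘L tderiv E E (fun h : G => g * h) 1 = .id ℝ E := by
  have h := tderiv_comp E E E (g := fun h : G => g⁻¹ * h) (f := fun h : G => g * h) (x := 1)
    (mdifferentiableAt_mul_left _ _) (mdifferentiableAt_mul_left _ _)
  rw [mul_one] at h
  rw [← h]
  simpa using tderiv_id E (1 : G)

theorem tderiv_mul_comp_inv_mul (g : G) :
    tderiv E E (fun h : G => g * h) 1 ∘L tderiv E E (fun h : G => g⁻¹ * h) g = .id ℝ E := by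
  have h := tderiv_comp E E E (g := fun h : G => g * h) (f := fun h : G => g⁻¹ * h) (x := g)
    (mdifferentiableAt_mul_left _ _) (mdifferentiableAt_mul_left _ _)
  rw [inv_mul_cancel] at h
  rw [← h]
  simpa using tderiv_id E (g : G)

/-- A derivative usually takes values in a moving tangent space, and its smoothness only makes sense
in bundle coordinates. When f y y is constantly c, the values stay in T_c and these coordinates are
trivial. -/
theorem contDiffAt_tderiv_of_const {E' : Type*} [NormedAddCommGroup E'] [NormedSpace ℝ E']
    {M' : Type*} [TopologicalSpace M'] [ChartedSpace E' M'] [IsManifold 𝓘(ℝ, E') ∞ M']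
    {f : F → F → M'} {x : F} (c : M')
    (hf : ContMDiffAt (𝓘(ℝ, F).prod 𝓘(ℝ, F)) 𝓘(ℝ, E') ∞ (Function.uncurry f) (x, x))
    (hc : ∀ y, f y y = c) :
    ContDiffAt ℝ ∞ (fun y => tderiv F E' (f y) y) x := by
  have : IsManifold 𝓘(ℝ, E') 1 M' := IsManifold.of_le (n := ∞) (by simp)
  have h : ContMDiffAt 𝓘(ℝ, F) 𝓘(ℝ, F →L[ℝ] E') ∞
      (inTangentCoordinates 𝓘(ℝ, F) 𝓘(ℝ, E') (fun y => y) (fun y => f y y)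
        (fun y => tderiv F E' (f y) y) x) x :=
    ContMDiffAt.mfderiv (m := ∞) f (fun y => y) hf contMDiffAt_id (by simp)
  have h2 : inTangentCoordinates 𝓘(ℝ, F) 𝓘(ℝ, E') (fun y => y) (fun y => f y y)
      (fun y => tderiv F E' (f y) y) x = fun y => tderiv F E' (f y) y := by
    funext y
    rw [inTangentCoordinates_eq (I := 𝓘(ℝ, F)) (I' := 𝓘(ℝ, E')) _ _ _ (Set.mem_univ y)
      (by simp only [hc]; exact mem_chart_source E' c)]
    simp only [hc]
    ext v
    simp only [ContinuousLinearMap.comp_apply]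
    rw [tangentBundleCore_coordChange_model_space, VectorBundleCore.coordChange_self]
    · rfl
    · exact mem_chart_source E' c
  rw [h2] at h
  exact h.contDiffAt

/-- The family f y z = u(y)⁻¹u(z) is 1 on the diagonal, so `contDiffAt_tderiv_of_const` applies. -/
theorem contDiffAt_logDeriv {u : F → G} {x : F} (hu : ContMDiffAt 𝓘(ℝ, F) 𝓘(ℝ, E) ∞ u x) :
    ContDiffAt ℝ ∞ (logDeriv E F u) x := by
  have h : ContDiffAt ℝ ∞ (fun y => tderiv F E (fun z => (u y)⁻¹ * u z) y) x := by
    refine contDiffAt_tderiv_of_const (1 : G) ?_ (by simp)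
    have h1 : ContMDiffAt (𝓘(ℝ, F).prod 𝓘(ℝ, F)) 𝓘(ℝ, E) ∞ (fun p : F × F => u p.1) (x, x) :=
      ContMDiffAt.comp (x, x) (g := u) hu contMDiffAt_fst
    have h2 : ContMDiffAt (𝓘(ℝ, F).prod 𝓘(ℝ, F)) 𝓘(ℝ, E) ∞ (fun p : F × F => u p.2) (x, x) :=
      ContMDiffAt.comp (x, x) (g := u) hu contMDiffAt_snd
    exact h1.inv.mul h2
  refine h.congr_of_eventuallyEq ?_
  filter_upwards [ContMDiffAt.eventually_mdifferentiableAt hu] with y hy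
  exact logDeriv_eq hy

end LogarithmicDerivative

/-! ### The Maurer-Cartan equation and the derivative of the adjoint action -/

section MaurerCartan

open VectorField

variable {E : Type*} [NormedAddCommGroup E] [NormedSpace ℝ E]
  {G : Type*} [TopologicalSpace G] [ChartedSpace E G] [Group G]
  {EM : Type*} [NormedAddCommGroup EM] [NormedSpace ℝ EM]
  {M : Type*} [TopologicalSpace M] [ChartedSpace EM M]
  {F : Type*} [NormedAddCommGroup F] [NormedSpace ℝ F]
  [LieGroup 𝓘(ℝ, E) ∞ G]

theorem contDiffAt_one_form_iff {V : Type*} [NormedAddCommGroup V] [NormedSpace ℝ V]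
    {F' : Type*} [NormedAddCommGroup F'] [NormedSpace ℝ F'] {a : F' → F [⋀^Fin 1]→L[ℝ] V}
    {x : F'} {n : WithTop ℕ∞} :
    ContDiffAt ℝ n a x ↔ ContDiffAt ℝ n
      (fun y => (ContinuousAlternatingMap.ofSubsingleton ℝ F V (0 : Fin 1)).symm (a y)) x :=
  ((ContinuousAlternatingMap.ofSubsingletonLIE (𝕜 := ℝ) (E := F) (F := V)
      (0 : Fin 1)).symm.toContinuousLinearEquiv.comp_contDiffAt_iff (f := a)).symm

variable (E G) in
theorem maurerCartan_isSmooth : (maurerCartan E G).IsSmooth := by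
  refine DForm.isSmooth_of_isSmoothAt fun g => ?_
  rw [DForm.IsSmoothAt, contDiffAt_one_form_iff]
  exact contDiffAt_logDeriv (contMDiffAt_chart_symm E (mem_extChartAt_target g))

variable (E) in
/-- The expression of a left-invariant vector field in the preferred chart at `g`. -/
def invariantFieldInChart (g : G) (ξ : E) (x : E) : E :=
  (tderiv E E (extChartAt 𝓘(ℝ, E) g).symm x).inverse
    (tderiv E E (fun h : G => (extChartAt 𝓘(ℝ, E) g).symm x * h) 1 ξ)

omit [LieGroup 𝓘(ℝ, E) ∞ G] in
theorem mpullbackWithin_eq_invariantFieldInChart (g : G) (ξ : GroupLieAlgebra 𝓘(ℝ, E) G) :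
    (mpullbackWithin 𝓘(ℝ, E) 𝓘(ℝ, E) (extChartAt 𝓘(ℝ, E) g).symm (mulInvariantVectorField ξ)
      (Set.range 𝓘(ℝ, E)) : E → E) = invariantFieldInChart E g ξ := by
  funext x
  have h : ∀ s : Set E, s = Set.univ → mpullbackWithin 𝓘(ℝ, E) 𝓘(ℝ, E)
      (extChartAt 𝓘(ℝ, E) g).symm (mulInvariantVectorField ξ) s x =
        invariantFieldInChart E g ξ x := by
    rintro _ rfl
    rw [mpullbackWithin_apply, mfderivWithin_univ]
    rfl
  exact h _ (ModelWithCorners.range_eq_univ _)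

/-- A left-invariant field has constant Maurer-Cartan value; this is what kills the derivative terms
in `d_maurerCartan`. -/
theorem maurerCartan_inChart_invariantField (g : G) (ξ : E) {x : E}
    (hx : x ∈ (extChartAt 𝓘(ℝ, E) g).target) :
    (maurerCartan E G).inChart g x ![invariantFieldInChart E g ξ x] = ξ := by
  have : IsManifold 𝓘(ℝ, E) 1 G := IsManifold.of_le (n := ∞) (by simp)
  have h : (tderiv E E (extChartAt 𝓘(ℝ, E) g).symm x).IsInvertible := by
    have h := isInvertible_mfderivWithin_extChartAt_symm (I := 𝓘(ℝ, E)) hx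
    rw [ModelWithCorners.range_eq_univ, mfderivWithin_univ] at h
    exact h
  rw [DForm.inChart_eq_along, maurerCartan_along_apply, logDeriv, ContinuousLinearMap.comp_apply,
    invariantFieldInChart, h.self_apply_inverse]
  exact DFunLike.congr_fun (tderiv_inv_mul_comp_mul _) ξ

variable (E G) in
theorem lieGroup_minSmoothness : LieGroup 𝓘(ℝ, E) (minSmoothness ℝ 3) G :=
  LieGroup.of_le (n := ∞) (by
    rw [minSmoothness_of_isRCLikeNormedField]; exact ENat.LEInfty.out)

variable [FiniteDimensional ℝ E]

theorem differentiableAt_invariantFieldInChart (g : G) (ξ : E) :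
    DifferentiableAt ℝ (invariantFieldInChart E g ξ) (extChartAt 𝓘(ℝ, E) g g) := by
  have := FiniteDimensional.complete ℝ E
  have := lieGroup_minSmoothness E G
  have : IsManifold 𝓘(ℝ, E) 2 G := IsManifold.of_le (n := ∞) ENat.LEInfty.out
  have h := mdifferentiableAt_mulInvariantVectorField (I := 𝓘(ℝ, E)) (G := G) ξ (g := g)
  have h2 := h.mdifferentiableWithinAt
    (s := Set.univ).differentiableWithinAt_mpullbackWithin_vectorField
  have h3 := (congrArg (fun f : E → E => DifferentiableWithinAt ℝ f
    ((extChartAt 𝓘(ℝ, E) g).symm ⁻¹' Set.univ ∩ Set.range 𝓘(ℝ, E)) (extChartAt 𝓘(ℝ, E) g g))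
      (mpullbackWithin_eq_invariantFieldInChart g ξ)).mp h2
  have hs : (extChartAt 𝓘(ℝ, E) g).symm ⁻¹' Set.univ ∩ Set.range 𝓘(ℝ, E) = Set.univ := by simp
  rw [hs] at h3
  exact differentiableWithinAt_univ.1 h3

theorem lieBracket_invariantFieldInChart (g : G) (ξ η : E) :
    lieBracket ℝ (invariantFieldInChart E g ξ) (invariantFieldInChart E g η)
      (extChartAt 𝓘(ℝ, E) g g) =
      tderiv E E (fun h : G => g * h) 1 (bracketL E G ξ η) := by
  have := FiniteDimensional.complete ℝ E
  have := lieGroup_minSmoothness E G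
  have h := congrFun (mulInvariantVector_mlieBracket (I := 𝓘(ℝ, E)) (G := G) ξ η) g
  refine Eq.trans ?_ h.symm
  -- The manifold bracket at g is a bracket of chart pullbacks transported by the chart derivative.
  -- Stating the claim for arbitrary L, s, V, W lets the three identifications be substituted
  -- simultaneously.
  have gen : ∀ L : E →L[ℝ] E, L = .id ℝ E → ∀ s : Set E, s = Set.univ → ∀ V W : E → E,
      V = invariantFieldInChart E g ξ → W = invariantFieldInChart E g η →
      lieBracket ℝ (invariantFieldInChart E g ξ) (invariantFieldInChart E g η)
        (extChartAt 𝓘(ℝ, E) g g) =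
        L.inverse (lieBracketWithin ℝ V W s (extChartAt 𝓘(ℝ, E) g g)) := by
    rintro _ rfl _ rfl _ _ rfl rfl
    simp
  exact gen _ (tderiv_chart_self E g) _ (by simp) _ _
    (mpullbackWithin_eq_invariantFieldInChart g ξ) (mpullbackWithin_eq_invariantFieldInChart g η)

/-- The Maurer-Cartan equation. -/
theorem d_maurerCartan (g : G) :
    (maurerCartan E G).d.val g = - wedgeSelf G ((maurerCartan E G).val g) := by
  refine alternating_two_ext fun v w => ?_
  have hT : ∀ᶠ y in 𝓝 (extChartAt 𝓘(ℝ, E) g g), y ∈ (extChartAt 𝓘(ℝ, E) g).target :=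
    (isOpen_extChartAt_target g).mem_nhds (mem_extChartAt_target g)
  have hval : ∀ v : E, (maurerCartan E G).inChart g (extChartAt 𝓘(ℝ, E) g g) ![v] =
      tderiv E E (fun h : G => g⁻¹ * h) g v := fun v => by
    rw [DForm.inChart_eq_along, maurerCartan_along_apply, logDeriv, tderiv_chart_symm_self,
      extChartAt_to_inv]
    rfl
  have hfield : ∀ v : E, invariantFieldInChart E g (tderiv E E (fun h : G => g⁻¹ * h) g v)
      (extChartAt 𝓘(ℝ, E) g g) = v := fun v => by
    rw [invariantFieldInChart, tderiv_chart_symm_self, extChartAt_to_inv]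
    simpa using DFunLike.congr_fun (tderiv_mul_comp_inv_mul g) v
  have hd : DifferentiableAt ℝ ((maurerCartan E G).inChart g) (extChartAt 𝓘(ℝ, E) g g) :=
    ContDiffAt.differentiableAt ((maurerCartan_isSmooth E G).isSmoothAt g) (by simp)
  -- Invariant formula dα(V,W) = V α(W) - W α(V) - α([V,W]) for the left-invariant fields extending
  -- v and w. The functions α(V), α(W) are constant near g, so only the bracket term survives.
  have h := extDeriv_apply_vectorField hd
    (V := ![invariantFieldInChart E g (tderiv E E (fun h : G => g⁻¹ * h) g v),
      invariantFieldInChart E g (tderiv E E (fun h : G => g⁻¹ * h) g w)])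
    (fun i => by fin_cases i <;> exact differentiableAt_invariantFieldInChart g _)
  have hV : (fun i => (![invariantFieldInChart E g (tderiv E E (fun h : G => g⁻¹ * h) g v),
      invariantFieldInChart E g (tderiv E E (fun h : G => g⁻¹ * h) g w)] : Fin 2 → E → E) i
        (extChartAt 𝓘(ℝ, E) g g)) = ![v, w] := by
    ext i
    fin_cases i
    · exact hfield v
    · exact hfield w
  have hconst : ∀ (ξ : E) (V : E → Fin 1 → E),
      (∀ x, V x = ![invariantFieldInChart E g ξ x]) →
      fderiv ℝ (fun x => (maurerCartan E G).inChart g x (V x)) (extChartAt 𝓘(ℝ, E) g g) = 0 := by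
    intro ξ V hV
    rw [Filter.EventuallyEq.fderiv_eq (f := fun _ => ξ)]
    · simp
    · filter_upwards [hT] with x hx
      rw [hV, maurerCartan_inChart_invariantField g ξ hx]
  rw [hV] at h
  have hbr : (maurerCartan E G).inChart g (extChartAt 𝓘(ℝ, E) g g)
      ![lieBracket ℝ (invariantFieldInChart E g (tderiv E E (fun h : G => g⁻¹ * h) g v))
        (invariantFieldInChart E g (tderiv E E (fun h : G => g⁻¹ * h) g w))
          (extChartAt 𝓘(ℝ, E) g g)] =
      bracketL E G ((maurerCartan E G).val g ![v]) ((maurerCartan E G).val g ![w]) := by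
    rw [hval, lieBracket_invariantFieldInChart, maurerCartan_val_apply, maurerCartan_val_apply]
    exact DFunLike.congr_fun (tderiv_inv_mul_comp_mul g) _
  rw [DForm.val_d, h, ContinuousAlternatingMap.neg_apply, wedgeSelf_apply, Fin.sum_univ_two,
    hconst (tderiv E E (fun h : G => g⁻¹ * h) g w) _ (fun x => by ext i; fin_cases i; rfl),
    hconst (tderiv E E (fun h : G => g⁻¹ * h) g v) _ (fun x => by ext i; fin_cases i; rfl),
    ← hbr]
  -- For a 1-form the bracket sum of the invariant formula has the single term i = j = 0.
  have hsum : ∀ f : Fin 1 → Fin 1 → E, ∑ i, ∑ j ≥ i, f i j = f 0 0 := fun f => by simp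
  simp only [zero_apply, smul_zero, add_zero, zero_sub, neg_inj]
  refine (hsum _).trans ?_
  simp only [Fin.val_zero, add_zero, pow_zero, one_smul]
  congr 1

theorem extDeriv_one_form_apply {V : Type*} [NormedAddCommGroup V] [NormedSpace ℝ V]
    {a : F → F [⋀^Fin 1]→L[ℝ] V} {x : F} (ha : DifferentiableAt ℝ a x) (v w : F) :
    extDeriv a x ![v, w] =
      fderiv ℝ (fun y => a y ![w]) x v - fderiv ℝ (fun y => a y ![v]) x w := by
  rw [extDeriv_apply ha, Fin.sum_univ_two]
  have h1 : (0 : Fin 2).removeNth ![v, w] = ![w] := by ext i; fin_cases i; rfl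
  have h2 : (1 : Fin 2).removeNth ![v, w] = ![v] := by ext i; fin_cases i; rfl
  rw [h1, h2]
  simp [sub_eq_add_neg]

/-- This is the Maurer-Cartan equation pulled back along u, since u⁻¹du is the pullback of g⁻¹dg. -/
theorem fderiv_logDeriv {u : F → G} {x : F} (hu : ContMDiffAt 𝓘(ℝ, F) 𝓘(ℝ, E) ∞ u x) (v w : F) :
    fderiv ℝ (fun y => logDeriv E F u y w) x v - fderiv ℝ (fun y => logDeriv E F u y v) x w =
      - bracketL E G (logDeriv E F u x v) (logDeriv E F u x w) := by
  have hs := (maurerCartan_isSmooth E G).isSmoothAt (u x)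
  have h := extDeriv_one_form_apply ((hs.along hu).differentiableAt (by simp)) v w
  rw [DForm.extDeriv_along hs hu, DForm.along, d_maurerCartan, compContinuousLinearMap_apply_two,
    ContinuousAlternatingMap.neg_apply, wedgeSelf_apply] at h
  exact h.symm

omit [FiniteDimensional ℝ E] in
variable (E) in
-- A straight line in the chart at 1 suffices: only the velocity at 0 matters, and no one-parameter
-- subgroup is required.
theorem exists_curve_logDeriv (η : E) : ∃ c : ℝ → G, c 0 = 1 ∧
    ContMDiffAt 𝓘(ℝ, ℝ) 𝓘(ℝ, E) ∞ c 0 ∧ logDeriv E ℝ c 0 1 = η := by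
  set e := extChartAt 𝓘(ℝ, E) (1 : G) with he
  have hl : ContDiff ℝ ∞ (fun t : ℝ => e 1 + t • η) :=
    contDiff_const.add (contDiff_id.smul contDiff_const)
  have he1 : ContMDiffAt 𝓘(ℝ, E) 𝓘(ℝ, E) ∞ e.symm (e 1 + (0 : ℝ) • η) := by
    rw [zero_smul, add_zero]
    exact contMDiffAt_chart_symm E (mem_extChartAt_target 1)
  have h0 : e.symm (e 1 + (0 : ℝ) • η) = 1 := by
    rw [zero_smul, add_zero]
    exact extChartAt_to_inv 1
  have hd : fderiv ℝ (fun t : ℝ => e 1 + t • η) 0 1 = η := by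
    rw [fderiv_const_add, fderiv_smul_const differentiableAt_id]
    simp
  refine ⟨fun t => e.symm (e 1 + t • η), h0,
    ContMDiffAt.comp (0 : ℝ) he1 hl.contMDiff.contMDiffAt, ?_⟩
  rw [logDeriv, ContinuousLinearMap.comp_apply,
    tderiv_comp ℝ E E (f := fun t : ℝ => e 1 + t • η) (he1.mdifferentiableAt (by simp))
      (hl.contMDiff.mdifferentiableAt (by simp)), ContinuousLinearMap.comp_apply,
    tderiv_eq_fderiv, hd, zero_smul, add_zero, he, tderiv_chart_symm_self, extChartAt_to_inv]
  simpa using DFunLike.congr_fun (tderiv_id E (1 : G)) η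

theorem bracketL_skew (a b : E) : bracketL E G a b = - bracketL E G b a := by
  have := FiniteDimensional.complete ℝ E
  have := lieGroup_minSmoothness E G
  exact (lie_skew (L := GroupLieAlgebra 𝓘(ℝ, E) G) a b).symm

omit [FiniteDimensional ℝ E] in
theorem logDeriv_curve_mul {c : ℝ → G} {u : F → G} {t : ℝ} {y : F}
    (hc : MDifferentiableAt 𝓘(ℝ, ℝ) 𝓘(ℝ, E) c t) (hu : MDifferentiableAt 𝓘(ℝ, F) 𝓘(ℝ, E) u y)
    (s : ℝ) (v : F) :
    logDeriv E (ℝ × F) (fun p : ℝ × F => c p.1 * u p.2) (t, y) (s, v) =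
      logDeriv E F u y v + Ad E (u y)⁻¹ (logDeriv E ℝ c t s) := by
  have h1 : MDifferentiableAt 𝓘(ℝ, ℝ × F) 𝓘(ℝ, ℝ) (Prod.fst : ℝ × F → ℝ) (t, y) :=
    differentiableAt_fst.mdifferentiableAt
  have h2 : MDifferentiableAt 𝓘(ℝ, ℝ × F) 𝓘(ℝ, F) (Prod.snd : ℝ × F → F) (t, y) :=
    differentiableAt_snd.mdifferentiableAt
  rw [logDeriv_mul (a := fun p : ℝ × F => c p.1) (b := fun p : ℝ × F => u p.2)
    (MDifferentiableAt.comp (t, y) (g := c) hc h1)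
    (MDifferentiableAt.comp (t, y) (g := u) hu h2), logDeriv_comp (u := c) hc h1,
    logDeriv_comp (u := u) hu h2, tderiv_eq_fderiv, tderiv_eq_fderiv, fderiv_fst, fderiv_snd]
  rfl

/-- Let c have velocity η at 1 and put W(t,y) = c(t)u(y). By the product rule, Ad(u(y)⁻¹)η is the
t-component of W⁻¹dW at t = 0, hence smooth in y. The y-component is u⁻¹du, independent of t, so in
the Maurer-Cartan equation for W its t-derivative drops out and the y-derivative of Ad(u⁻¹)η equals
a bracket. -/
theorem contDiffAt_Ad_inv_apply {u : F → G} {x : F} (hu : ContMDiffAt 𝓘(ℝ, F) 𝓘(ℝ, E) ∞ u x)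
    (η : E) : ContDiffAt ℝ ∞ (fun y => Ad E (u y)⁻¹ η) x ∧
      ∀ v, fderiv ℝ (fun y => Ad E (u y)⁻¹ η) x v =
        - bracketL E G (logDeriv E F u x v) (Ad E (u x)⁻¹ η) := by
  obtain ⟨c, hc0, hc, hcη⟩ := exists_curve_logDeriv (G := G) E η
  have hW : ContMDiffAt 𝓘(ℝ, ℝ × F) 𝓘(ℝ, E) ∞ (fun p : ℝ × F => c p.1 * u p.2) (0, x) :=
    (ContMDiffAt.comp (0, x) (g := c) hc contDiff_fst.contMDiff.contMDiffAt).mul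
      (ContMDiffAt.comp (0, x) (g := u) hu contDiff_snd.contMDiff.contMDiffAt)
  have hL := contDiffAt_logDeriv hW
  have hLd := hL.differentiableAt (by simp)
  have hdc := hc.mdifferentiableAt (by simp)
  have hdu := hu.mdifferentiableAt (by simp)
  have hu' := ContMDiffAt.eventually_mdifferentiableAt hu
  have hc' := ContMDiffAt.eventually_mdifferentiableAt hc
  have hA : (fun y => Ad E (u y)⁻¹ η) =ᶠ[𝓝 x] fun y =>
      logDeriv E (ℝ × F) (fun p : ℝ × F => c p.1 * u p.2) (0, y) (1, 0) := by
    filter_upwards [hu'] with y hy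
    rw [logDeriv_curve_mul hdc hy, hcη, map_zero, zero_add]
  have hi : ContDiff ℝ ∞ (fun y : F => ((0 : ℝ), y)) := contDiff_const.prodMk contDiff_id
  refine ⟨ContDiffAt.congr_of_eventuallyEq ?_ hA, fun v => ?_⟩
  · exact (ContDiffAt.comp x (f := fun y : F => ((0 : ℝ), y)) hL hi.contDiffAt).clm_apply
      contDiffAt_const
  have hcurv := fderiv_logDeriv hW (1, 0) (0, v)
  rw [logDeriv_curve_mul hdc hdu, logDeriv_curve_mul hdc hdu, hcη] at hcurv
  -- Along t ↦ (t, x) the component in direction (0, v) is constantly u⁻¹du(v).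
  have e1 : fderiv ℝ (fun p => logDeriv E (ℝ × F) (fun p : ℝ × F => c p.1 * u p.2) p (0, v))
      (0, x) (1, 0) = 0 := by
    have hd := ((hLd.clm_apply (differentiableAt_const ((0 : ℝ), v))).hasFDerivAt).comp_hasDerivAt
      (0 : ℝ) ((hasDerivAt_id (0 : ℝ)).prodMk (hasDerivAt_const (0 : ℝ) x))
    refine hd.unique ((hasDerivAt_const (0 : ℝ) (logDeriv E F u x v)).congr_of_eventuallyEq ?_)
    filter_upwards [hc'] with t ht
    exact (logDeriv_curve_mul ht hdu 0 v).trans (by rw [map_zero, map_zero, add_zero])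
  have e2 : fderiv ℝ (fun y => Ad E (u y)⁻¹ η) x v =
      fderiv ℝ (fun p => logDeriv E (ℝ × F) (fun p : ℝ × F => c p.1 * u p.2) p (1, 0))
        (0, x) (0, v) := by
    have hd := ((hLd.clm_apply (differentiableAt_const ((1 : ℝ), (0 : F)))).hasFDerivAt).comp x
      ((hasFDerivAt_const (0 : ℝ) x).prodMk (hasFDerivAt_id x))
    rw [hA.fderiv_eq]
    exact DFunLike.congr_fun hd.fderiv v
  rw [e1, ← e2] at hcurv
  rw [map_zero, map_zero, map_zero, zero_add, add_zero, zero_sub, neg_inj] at hcurv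
  rw [hcurv, bracketL_skew]

end MaurerCartan

/-! ### The adjoint action, invariant metrics and subgroups -/

section Adjoint

variable {E : Type*} [NormedAddCommGroup E] [NormedSpace ℝ E] [FiniteDimensional ℝ E]
  {G : Type*} [TopologicalSpace G] [ChartedSpace E G] [Group G] [LieGroup 𝓘(ℝ, E) ∞ G]
  {EM : Type*} [NormedAddCommGroup EM] [NormedSpace ℝ EM]
  {M : Type*} [TopologicalSpace M] [ChartedSpace EM M]
  {F : Type*} [NormedAddCommGroup F] [NormedSpace ℝ F]

theorem contDiffAt_clm_of_apply {V W : Type*} [NormedAddCommGroup V] [NormedSpace ℝ V]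
    [FiniteDimensional ℝ V] [NormedAddCommGroup W] [NormedSpace ℝ W] {f : F → V →L[ℝ] W} {x : F}
    {n : WithTop ℕ∞} (h : ∀ v, ContDiffAt ℝ n (fun y => f y v) x) : ContDiffAt ℝ n f x := by
  let e₁ := ContinuousLinearEquiv.ofFinrankEq
    (Module.finrank_fin_fun ℝ (n := Module.finrank ℝ V)).symm
  let e₂ := (e₁.arrowCongr (ContinuousLinearEquiv.refl ℝ W)).trans
    (ContinuousLinearEquiv.piRing (Fin (Module.finrank ℝ V)))
  rw [← e₂.comp_contDiffAt_iff]
  exact contDiffAt_pi.2 fun i => h _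

theorem contDiffAt_Ad_inv {u : F → G} {x : F} (hu : ContMDiffAt 𝓘(ℝ, F) 𝓘(ℝ, E) ∞ u x) :
    ContDiffAt ℝ ∞ (fun y => Ad E (u y)⁻¹) x :=
  contDiffAt_clm_of_apply fun η => (contDiffAt_Ad_inv_apply hu η).1

theorem contMDiff_Ad_inv [IsManifold 𝓘(ℝ, EM) ∞ M] {u : M → G}
    (hu : ContMDiff 𝓘(ℝ, EM) 𝓘(ℝ, E) ∞ u) :
    ContMDiff 𝓘(ℝ, EM) 𝓘(ℝ, E →L[ℝ] E) ∞ (fun m => Ad E (u m)⁻¹) := fun m => by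
  have h1 := (contDiffAt_Ad_inv (ContMDiffAt.comp_chart_symm (hu m))).contMDiffAt
  have h2 := ContMDiffAt.comp m h1 (contMDiffAt_chart EM (mem_extChartAt_source m))
  refine h2.congr_of_eventuallyEq ?_
  filter_upwards [extChartAt_source_mem_nhds (I := 𝓘(ℝ, EM)) m] with y hy
  simp only [Function.comp_apply, (extChartAt 𝓘(ℝ, EM) m).left_inv hy]

theorem contMDiff_Ad [IsManifold 𝓘(ℝ, EM) ∞ M] {u : M → G}
    (hu : ContMDiff 𝓘(ℝ, EM) 𝓘(ℝ, E) ∞ u) :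
    ContMDiff 𝓘(ℝ, EM) 𝓘(ℝ, E →L[ℝ] E) ∞ (fun m => Ad E (u m)) := by
  simpa using contMDiff_Ad_inv hu.inv

/-- Right translation by g⁻¹ turns u⁻¹du into Ad(g) u⁻¹du. Comparing the Maurer-Cartan equations of
u and ug⁻¹, with u the inverse chart at 1, shows that Ad(g) respects brackets. -/
theorem Ad_bracketL (g : G) (a b : E) :
    Ad E g (bracketL E G a b) = bracketL E G (Ad E g a) (Ad E g b) := by
  set x := extChartAt 𝓘(ℝ, E) (1 : G) 1
  let u : E → G := (extChartAt 𝓘(ℝ, E) (1 : G)).symm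
  have hu : ContMDiffAt 𝓘(ℝ, E) 𝓘(ℝ, E) ∞ u x :=
    contMDiffAt_chart_symm E (mem_extChartAt_target 1)
  have hux : u x = 1 := extChartAt_to_inv 1
  have hl : ∀ v, logDeriv E E u x v = v := fun v => by
    rw [logDeriv, tderiv_chart_symm_self, hux]
    simpa using DFunLike.congr_fun (tderiv_id E (1 : G)) v
  have hug : ContMDiffAt 𝓘(ℝ, E) 𝓘(ℝ, E) ∞ (fun y => u y * g⁻¹) x := hu.mul contMDiffAt_const
  have hev : ∀ v, (fun y => logDeriv E E (fun y => u y * g⁻¹) y v) =ᶠ[𝓝 x]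
      fun y => Ad E g (logDeriv E E u y v) := fun v => by
    filter_upwards [ContMDiffAt.eventually_mdifferentiableAt hu] with y hy
    rw [logDeriv_mul_const hy, inv_inv]
    rfl
  have hd : ∀ v w, fderiv ℝ (fun y => logDeriv E E (fun y => u y * g⁻¹) y v) x w =
      Ad E g (fderiv ℝ (fun y => logDeriv E E u y v) x w) := fun v w => by
    rw [(hev v).fderiv_eq]
    have hdl := ((contDiffAt_logDeriv hu).differentiableAt (by simp)).clm_apply
      (differentiableAt_const v)
    exact DFunLike.congr_fun ((Ad E g).hasFDerivAt.comp x hdl.hasFDerivAt).fderiv w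
  have h1 := fderiv_logDeriv hu a b
  have h2 := fderiv_logDeriv hug a b
  rw [hd, hd, ← map_sub, h1, (hev a).eq_of_nhds, (hev b).eq_of_nhds, hl, hl, map_neg,
    neg_inj] at h2
  exact h2

omit [FiniteDimensional ℝ E] in
-- Conjugation is a left translation followed by a right one, and both are isometries.
theorem innerForm_Ad {met : Metric E G} (hmet : IsBiInvariant met) (g : G) (u v : E) :
    innerForm met (Ad E g u) (Ad E g v) = innerForm met u v := by
  let I : G → E →L[ℝ] E →L[ℝ] ℝ := fun x => met.inner x
  have hL : ∀ (x : G) (u v : E), I (g * x) (tderiv E E (fun y : G => g * y) x u)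
      (tderiv E E (fun y : G => g * y) x v) = I x u v := fun x u v => (hmet g x u v).1
  have hR : ∀ (x : G) (u v : E), I (x * g⁻¹) (tderiv E E (fun y : G => y * g⁻¹) x u)
      (tderiv E E (fun y : G => y * g⁻¹) x v) = I x u v := fun x u v => (hmet g⁻¹ x u v).2
  have hAd : Ad E g = tderiv E E (fun y : G => y * g⁻¹) (g * 1) ∘L
      tderiv E E (fun y : G => g * y) 1 :=
    tderiv_comp E E E ((contMDiff_mul_right (n := ∞)).mdifferentiableAt (by simp))
      (mdifferentiableAt_mul_left g 1)
  have h := (hR (g * 1) _ _).trans (hL 1 u v)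
  have h2 : I (g * 1 * g⁻¹) (Ad E g u) (Ad E g v) = I 1 u v := by rw [hAd]; exact h
  rw [mul_one, mul_inv_cancel] at h2
  exact h2

/-! ### Orthogonal projections for the metric and their equivariance -/

section Projections

variable {met : Metric E G}

theorem prPar_eq_of_mem {W : Submodule ℝ E} {a v : E} (ha : a ∈ W)
    (hv : v - a ∈ (innerForm met).orthogonal W) : prPar met W v = a := by
  have h1 : prPar met W (v - a) = 0 :=
    (Submodule.projection_apply_eq_zero_iff (isCompl_orthogonal met W)).2 hv
  have h2 : prPar met W a = a :=
    Submodule.projection_apply_of_mem_left (isCompl_orthogonal met W) ha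
  rwa [map_sub, h2, sub_eq_zero] at h1

theorem prPar_mem (W : Submodule ℝ E) (v : E) : prPar met W v ∈ W :=
  Submodule.projection_apply_mem (isCompl_orthogonal met W) v

theorem sub_prPar_mem (W : Submodule ℝ E) (v : E) :
    v - prPar met W v ∈ (innerForm met).orthogonal W := by
  refine (Submodule.projection_apply_eq_zero_iff (isCompl_orthogonal met W)).1 ?_
  have h2 : prPar met W (prPar met W v) = prPar met W v :=
    Submodule.projection_apply_of_mem_left (isCompl_orthogonal met W) (prPar_mem W v)
  change prPar met W (v - prPar met W v) = 0
  rw [map_sub, h2, sub_self]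

theorem prPerp_apply (W : Submodule ℝ E) (v : E) : prPerp met W v = v - prPar met W v := by
  have h1 : prPerp met W (prPar met W v) = 0 :=
    (Submodule.projection_apply_eq_zero_iff (isCompl_orthogonal met W).symm).2 (prPar_mem W v)
  have h2 : prPerp met W (v - prPar met W v) = v - prPar met W v :=
    Submodule.projection_apply_of_mem_left (isCompl_orthogonal met W).symm (sub_prPar_mem W v)
  rwa [map_sub, h1, sub_zero] at h2

theorem prPar_of_mem {W : Submodule ℝ E} {v : E} (hv : v ∈ W) : prPar met W v = v :=
  prPar_eq_of_mem hv (by simp)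

theorem prPerp_of_mem {W : Submodule ℝ E} {v : E} (hv : v ∈ W) : prPerp met W v = 0 := by
  rw [prPerp_apply, prPar_of_mem hv, sub_self]

theorem prPar_of_mem_orthogonal {W : Submodule ℝ E} {v : E}
    (hv : v ∈ (innerForm met).orthogonal W) : prPar met W v = 0 :=
  prPar_eq_of_mem W.zero_mem (by simpa using hv)

theorem prPerp_mem (W : Submodule ℝ E) (v : E) :
    prPerp met W v ∈ (innerForm met).orthogonal W := by
  rw [prPerp_apply]
  exact sub_prPar_mem W v

theorem prPar_add_prPerp (W : Submodule ℝ E) (v : E) : prPar met W v + prPerp met W v = v := by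
  rw [prPerp_apply, add_sub_cancel]

/-- `Ad g` intertwines the projections onto `W` and onto `Ad(g) W`. -/
theorem prPar_Ad (hmet : IsBiInvariant met) {W W' : Submodule ℝ E} (g : G)
    (hW : ∀ v ∈ W, Ad E g v ∈ W') (hW' : ∀ v ∈ W', Ad E g⁻¹ v ∈ W) (v : E) :
    prPar met W' (Ad E g v) = Ad E g (prPar met W v) := by
  refine prPar_eq_of_mem (hW _ (prPar_mem W v)) ?_
  rw [← map_sub]
  intro n hn
  have h := sub_prPar_mem (met := met) W v _ (hW' n hn)
  change innerForm met _ _ = 0 at h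
  change innerForm met _ _ = 0
  rw [← innerForm_Ad hmet g, Ad_apply_inv] at h
  exact h

end Projections

/-! ### The Lie algebra of a subgroup: invariance under Ad(H) and brackets -/

section Subgroups

variable {H : Subgroup G}

omit [FiniteDimensional ℝ E] in
theorem tderiv_mem_subgroupLie {u : F → G} {x : F} (hu : ContMDiffAt 𝓘(ℝ, F) 𝓘(ℝ, E) ∞ u x)
    (hx : u x = 1) (hH : ∀ᶠ y in 𝓝 x, u y ∈ H) (v : F) :
    tderiv F E u x v ∈ subgroupLie (E := E) H := by
  classical
  have hl : ContDiff ℝ ∞ (fun t : ℝ => x + t • v) :=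
    contDiff_const.add (contDiff_id.smul contDiff_const)
  have hd : fderiv ℝ (fun t : ℝ => x + t • v) 0 1 = v := by
    rw [fderiv_const_add, fderiv_smul_const differentiableAt_id]
    simp
  have hu' : ContMDiffAt 𝓘(ℝ, F) 𝓘(ℝ, E) ∞ u (x + (0 : ℝ) • v) := by simpa using hu
  have hc : ContMDiffAt 𝓘(ℝ, ℝ) 𝓘(ℝ, E) ∞ (fun t : ℝ => u (x + t • v)) 0 :=
    ContMDiffAt.comp (0 : ℝ) hu' hl.contMDiff.contMDiffAt
  -- `subgroupLie` asks for curves that stay in H for all times. Replacing the values outside H by 1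
  -- does not change the germ at 0.
  have hev : (fun t : ℝ => if u (x + t • v) ∈ H then u (x + t • v) else 1) =ᶠ[𝓝 0]
      fun t : ℝ => u (x + t • v) := by
    have h0 : ∀ᶠ y in 𝓝 (x + (0 : ℝ) • v), u y ∈ H := by simpa using hH
    filter_upwards [hl.continuous.continuousAt.eventually h0] with t ht
    rw [if_pos ht]
  refine ⟨fun t => if u (x + t • v) ∈ H then u (x + t • v) else 1, by simp [hx], fun t => ?_,
    hc.congr_of_eventuallyEq hev, ?_⟩
  · dsimp only
    split_ifs with h
    · exact h
    · exact H.one_mem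
  have h := tderiv_congr ℝ E hev
  rw [tderiv_comp ℝ F E (f := fun t : ℝ => x + t • v) (hu'.mdifferentiableAt (by simp))
    (hl.contMDiff.mdifferentiableAt (by simp)), tderiv_eq_fderiv, zero_smul, add_zero] at h
  refine (DFunLike.congr_fun h 1).trans ?_
  exact congrArg (tderiv F E u x) hd

omit [FiniteDimensional ℝ E] in
theorem logDeriv_mem_subgroupLie [IsManifold 𝓘(ℝ, EM) ∞ M] {u : M → G} {x : M}
    (hu : ContMDiffAt 𝓘(ℝ, EM) 𝓘(ℝ, E) ∞ u x) (hH : ∀ᶠ y in 𝓝 x, (u x)⁻¹ * u y ∈ H) (v : EM) :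
    logDeriv E EM u x v ∈ subgroupLie (E := E) H := by
  have hu' : ContMDiffAt 𝓘(ℝ, EM) 𝓘(ℝ, E) ∞ (fun y => (u x)⁻¹ * u y) x :=
    contMDiffAt_const.mul hu
  have hs := contMDiffAt_chart_symm EM (mem_extChartAt_target (I := 𝓘(ℝ, EM)) x)
  have hH' : ∀ᶠ y in 𝓝 ((extChartAt 𝓘(ℝ, EM) x).symm (extChartAt 𝓘(ℝ, EM) x x)),
      (u x)⁻¹ * u y ∈ H := by rwa [extChartAt_to_inv]
  have h := tderiv_mem_subgroupLie (H := H) (ContMDiffAt.comp_chart_symm hu')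
    (by simp) (hs.continuousAt.eventually hH') v
  have hu'' : MDifferentiableAt 𝓘(ℝ, EM) 𝓘(ℝ, E) (fun y => (u x)⁻¹ * u y)
      ((extChartAt 𝓘(ℝ, EM) x).symm (extChartAt 𝓘(ℝ, EM) x x)) := by
    rw [extChartAt_to_inv]
    exact hu'.mdifferentiableAt (by simp)
  rw [tderiv_comp EM EM E hu'' (hs.mdifferentiableAt (by simp)), tderiv_chart_symm_self,
    extChartAt_to_inv, ← logDeriv_eq (hu.mdifferentiableAt (by simp))] at h
  exact h

omit [FiniteDimensional ℝ E] in
theorem exists_curve_of_mem_subgroupLie {ξ : E} (hξ : ξ ∈ subgroupLie (E := E) H) :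
    ∃ γ : ℝ → G, γ 0 = 1 ∧ (∀ t, γ t ∈ H) ∧ ContMDiffAt 𝓘(ℝ, ℝ) 𝓘(ℝ, E) ∞ γ 0 ∧
      tderiv ℝ E γ 0 1 = ξ := hξ

omit [FiniteDimensional ℝ E] in
theorem Ad_mem_subgroupLie {h : G} (hh : h ∈ H) {ξ : E} (hξ : ξ ∈ subgroupLie (E := E) H) :
    Ad E h ξ ∈ subgroupLie (E := E) H := by
  obtain ⟨γ, h0, hH, hs, rfl⟩ := exists_curve_of_mem_subgroupLie hξ
  have hc := tderiv_conj (hs.mdifferentiableAt (by simp)) h0 h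
  rw [show Ad E h (tderiv ℝ E γ 0 1) = tderiv ℝ E (fun y => h * γ y * h⁻¹) 0 1 by rw [hc]; rfl]
  exact tderiv_mem_subgroupLie ((contMDiffAt_const.mul hs).mul contMDiffAt_const) (by simp [h0])
    (Filter.Eventually.of_forall fun t =>
      H.mul_mem (H.mul_mem hh (hH t)) (H.inv_mem hh)) 1

omit [FiniteDimensional ℝ E] in
-- Another representative of gH differs from g by an element of H, and 𝔥 is Ad(H)-invariant.
theorem Ad_mem_isotropyLie {g : G} {ξ : E} (hξ : ξ ∈ subgroupLie (E := E) H) :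
    Ad E g ξ ∈ isotropyLie H (g : G ⧸ H) := by
  intro g' hg'
  obtain ⟨h, hh, rfl⟩ : ∃ h ∈ H, g = g' * h :=
    ⟨g'⁻¹ * g, QuotientGroup.eq.1 hg', by simp⟩
  rw [← ContinuousLinearMap.comp_apply, ← Ad_mul, inv_mul_cancel_left]
  exact Ad_mem_subgroupLie hh hξ

theorem prPar_Ad_subgroup {met : Metric E G} (hmet : IsBiInvariant met) {h : G} (hh : h ∈ H)
    (v : E) : prPar met (subgroupLie H) (Ad E h v) = Ad E h (prPar met (subgroupLie H) v) :=
  prPar_Ad hmet h (fun _ hv => Ad_mem_subgroupLie hh hv)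
    (fun _ hv => Ad_mem_subgroupLie (H.inv_mem hh) hv) v

theorem prPerp_Ad_subgroup {met : Metric E G} (hmet : IsBiInvariant met) {h : G} (hh : h ∈ H)
    (v : E) : prPerp met (subgroupLie H) (Ad E h v) = Ad E h (prPerp met (subgroupLie H) v) := by
  rw [prPerp_apply, prPerp_apply, prPar_Ad_subgroup hmet hh, map_sub]

theorem prPar_isotropyLie {met : Metric E G} (hmet : IsBiInvariant met) (g : G) (v : E) :
    prPar met (isotropyLie H (g : G ⧸ H)) (Ad E g v) = Ad E g (prPar met (subgroupLie H) v) :=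
  prPar_Ad hmet g (fun _ hv => Ad_mem_isotropyLie hv) (fun _ hv => hv g rfl) v

/-- Differentiate P(Ad(γ(t)⁻¹)η) = 0 at t = 0 along a curve γ in H with velocity ξ. Taking for P
either projection yields [𝔥,𝔥] ⊂ 𝔥 and [𝔥,𝔥^⊥] ⊂ 𝔥^⊥. -/
theorem map_bracketL_eq_zero {V : Type*} [NormedAddCommGroup V] [NormedSpace ℝ V] (P : E →L[ℝ] V)
    {ξ η : E} (hP : ∀ h ∈ H, P (Ad E h η) = 0) (hξ : ξ ∈ subgroupLie (E := E) H) :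
    P (bracketL E G ξ η) = 0 := by
  obtain ⟨γ, h0, hH, hs, rfl⟩ := exists_curve_of_mem_subgroupLie hξ
  obtain ⟨hd, hf⟩ := contDiffAt_Ad_inv_apply hs η
  have h1 : fderiv ℝ (fun t => P (Ad E (γ t)⁻¹ η)) 0 1 = 0 := by
    rw [show (fun t => P (Ad E (γ t)⁻¹ η)) = fun _ => 0 from
      funext fun t => hP _ (H.inv_mem (hH t))]
    simp
  have hl : logDeriv E ℝ γ 0 = tderiv ℝ E γ 0 := by
    rw [logDeriv, h0]
    simp only [inv_one, one_mul, tderiv_id]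
    rfl
  have h2 := (P.hasFDerivAt.comp (0 : ℝ) (hd.differentiableAt (by simp)).hasFDerivAt).fderiv
  rw [show (P ∘ fun t => Ad E (γ t)⁻¹ η) = fun t => P (Ad E (γ t)⁻¹ η) from rfl] at h2
  rw [h2, ContinuousLinearMap.comp_apply, hf, hl, h0, inv_one, Ad_one, map_neg, neg_eq_zero] at h1
  exact h1

theorem prPerp_bracketL_of_mem {met : Metric E G} {ξ η : E} (hξ : ξ ∈ subgroupLie (E := E) H)
    (hη : η ∈ subgroupLie (E := E) H) : prPerp met (subgroupLie H) (bracketL E G ξ η) = 0 :=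
  map_bracketL_eq_zero _ (fun _ hh => prPerp_of_mem (Ad_mem_subgroupLie hh hη)) hξ

theorem prPar_bracketL_prPerp {met : Metric E G} (hmet : IsBiInvariant met) {ξ : E}
    (hξ : ξ ∈ subgroupLie (E := E) H) (η : E) :
    prPar met (subgroupLie H) (bracketL E G ξ (prPerp met (subgroupLie H) η)) = 0 :=
  map_bracketL_eq_zero _ (fun _ hh => by
    rw [prPar_Ad_subgroup hmet hh, prPar_of_mem_orthogonal (prPerp_mem _ η), map_zero]) hξ

end Subgroups

end Adjoint

/-! ### The quotient map and the coisotropy form -/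

section Quotient

variable {E : Type*} [NormedAddCommGroup E] [NormedSpace ℝ E]
  {G : Type*} [TopologicalSpace G] [ChartedSpace E G] [Group G] [LieGroup 𝓘(ℝ, E) ∞ G]
  {H : Subgroup G}
  {EX : Type*} [NormedAddCommGroup EX] [NormedSpace ℝ EX] [ChartedSpace EX (G ⧸ H)]
  [IsManifold 𝓘(ℝ, EX) ∞ (G ⧸ H)]

omit [LieGroup 𝓘(ℝ, E) ∞ G] [IsManifold 𝓘(ℝ, EX) ∞ (G ⧸ H)] in
theorem contMDiff_quotient_mk (hπ : IsQuotientStructure E EX H) :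
    ContMDiff 𝓘(ℝ, E) 𝓘(ℝ, EX) ∞ (QuotientGroup.mk : G → G ⧸ H) := by
  obtain ⟨F, _, _, hF⟩ := hπ
  exact fun g => (hF g).contMDiffAt

omit [LieGroup 𝓘(ℝ, E) ∞ G] [IsManifold 𝓘(ℝ, EX) ∞ (G ⧸ H)] in
theorem exists_local_section (hπ : IsQuotientStructure E EX H) (g : G) :
    ∃ σ : G ⧸ H → G, σ g = g ∧ ContMDiffAt 𝓘(ℝ, EX) 𝓘(ℝ, E) ∞ σ (g : G ⧸ H) ∧
      ∀ᶠ y in 𝓝 (g : G ⧸ H), (σ y : G ⧸ H) = y := by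
  obtain ⟨F, _, _, hF⟩ := hπ
  have h := hF g
  set e := h.equiv
  set a := h.domChart
  set c := h.codChart
  have hga : g ∈ a.source := h.mem_domChart_source
  have hgc : (g : G ⧸ H) ∈ c.source := h.mem_codChart_source
  have key : ∀ x ∈ a.target, c ((a.symm x : G) : G ⧸ H) = (e x).1 := fun x hx => by
    have hx' : x ∈ (a.extend 𝓘(ℝ, E)).target := by simpa using hx
    simpa using h.writtenInCharts hx'
  have hσg : e.symm (c (g : G ⧸ H), (e (a g)).2) = a g := by
    have hcg := key (a g) (a.map_source hga)
    rw [a.left_inv hga] at hcg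
    rw [hcg]
    exact e.symm_apply_apply _
  have hin : ContMDiffAt 𝓘(ℝ, EX) 𝓘(ℝ, E) ∞
      (fun y => e.symm (c y, (e (a g)).2)) (g : G ⧸ H) :=
    e.symm.contDiff.contMDiff.contMDiffAt.comp _
      ((contMDiffAt_of_mem_maximalAtlas h.codChart_mem_maximalAtlas hgc).prodMk_space
        contMDiffAt_const)
  have ha : ContMDiffAt 𝓘(ℝ, E) 𝓘(ℝ, E) ∞ a.symm (e.symm (c (g : G ⧸ H), (e (a g)).2)) :=
    contMDiffAt_symm_of_mem_maximalAtlas h.domChart_mem_maximalAtlas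
      (by rw [hσg]; exact a.map_source hga)
  -- In submersion coordinates π is the projection to the first factor; the section keeps the fibre
  -- coordinate of g fixed.
  refine ⟨fun y => a.symm (e.symm (c y, (e (a g)).2)), by simp only [hσg, a.left_inv hga],
    ContMDiffAt.comp (g := a.symm) (f := fun y => e.symm (c y, (e (a g)).2)) _ ha hin, ?_⟩
  have h1 : ∀ᶠ y in 𝓝 (g : G ⧸ H), y ∈ c.source := c.open_source.mem_nhds hgc
  have h2 : ∀ᶠ y in 𝓝 (g : G ⧸ H), e.symm (c y, (e (a g)).2) ∈ a.target :=
    hin.continuousAt.eventually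
      (a.open_target.mem_nhds (by simp only [hσg]; exact a.map_source hga))
  filter_upwards [h1, h2] with y hy1 hy2
  have h3 := key _ hy2
  rw [ContinuousLinearEquiv.apply_symm_apply] at h3
  exact c.injOn (h.source_subset_preimage_source (a.map_target hy2)) hy1 h3

/-- Vectors tangent to the fibres of `G → G/H` are left translates of elements of `𝔥`. -/
theorem tderiv_inv_mul_mem_subgroupLie (hπ : IsQuotientStructure E EX H) {g : G} {η : E}
    (hη : tderiv E EX (QuotientGroup.mk : G → G ⧸ H) g η = 0) :
    tderiv E E (fun x : G => g⁻¹ * x) g η ∈ subgroupLie (E := E) H := by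
  have hmk := contMDiff_quotient_mk hπ
  obtain ⟨F, _, _, hF⟩ := hπ
  have h := hF g
  set e := h.equiv
  set a := h.domChart
  set c := h.codChart
  have hga : g ∈ a.source := h.mem_domChart_source
  have hgc : (g : G ⧸ H) ∈ c.source := h.mem_codChart_source
  have key : ∀ x ∈ a.target, c ((a.symm x : G) : G ⧸ H) = (e x).1 := fun x hx => by
    have hx' : x ∈ (a.extend 𝓘(ℝ, E)).target := by simpa using hx
    simpa using h.writtenInCharts hx'
  have hcsm := contMDiffAt_of_mem_maximalAtlas h.codChart_mem_maximalAtlas hgc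
  have hasm := contMDiffAt_of_mem_maximalAtlas h.domChart_mem_maximalAtlas hga
  -- r freezes the base coordinate at that of g, so a⁻¹ ∘ r maps into the fibre through g near a(g).
  -- Its derivative there fixes the vertical vectors, which exhibits η as a tangent vector of a map
  -- into gH.
  let r : E → E := fun y => e.symm ((e (a g)).1, (e y).2)
  have hr : ContDiff ℝ ∞ r :=
    e.symm.contDiff.comp (contDiff_const.prodMk (contDiff_snd.comp e.contDiff))
  have hrg : r (a g) = a g := e.symm_apply_apply _
  have hdr : ∀ v, fderiv ℝ r (a g) v = e.symm (0, (e v).2) := fun v => by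
    have h1 := (e.symm : (EX × F) →L[ℝ] E).hasFDerivAt.comp (a g)
      ((hasFDerivAt_const (e (a g)).1 (a g)).prodMk
        (((ContinuousLinearMap.snd ℝ EX F).comp (e : E →L[ℝ] EX × F)).hasFDerivAt))
    exact DFunLike.congr_fun h1.fderiv v
  have hsymm : ContMDiffAt 𝓘(ℝ, E) 𝓘(ℝ, E) ∞ a.symm (r (a g)) :=
    contMDiffAt_symm_of_mem_maximalAtlas h.domChart_mem_maximalAtlas
      (by rw [hrg]; exact a.map_source hga)
  have hu : ContMDiffAt 𝓘(ℝ, E) 𝓘(ℝ, E) ∞ (fun y => a.symm (r y)) (a g) :=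
    ContMDiffAt.comp (g := a.symm) (f := r) _ hsymm hr.contMDiff.contMDiffAt
  have hug : a.symm (r (a g)) = g := by rw [hrg, a.left_inv hga]
  set v := tderiv E E a g η with hv
  have hv1 : (e v).1 = 0 := by
    have hev : (fun y => (e (a y)).1) =ᶠ[𝓝 g] fun y : G => c (y : G ⧸ H) := by
      filter_upwards [a.open_source.mem_nhds hga] with y hy
      have h1 := key (a y) (a.map_source hy)
      rw [a.left_inv hy] at h1
      exact h1.symm
    have h1 := tderiv_congr E EX hev
    rw [tderiv_comp E EX EX (g := c) (f := (QuotientGroup.mk : G → G ⧸ H))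
      (hcsm.mdifferentiableAt (by simp)) (hmk.mdifferentiableAt (by simp)),
      tderiv_comp E E EX (g := fun y => (e y).1)
        ((contDiff_fst.comp e.contDiff).contMDiff.mdifferentiableAt (n := ∞) (by simp))
        (hasm.mdifferentiableAt (by simp)), tderiv_eq_fderiv] at h1
    have h2 := DFunLike.congr_fun h1 η
    rw [ContinuousLinearMap.comp_apply, ContinuousLinearMap.comp_apply, hη, map_zero] at h2
    have h3 := ((ContinuousLinearMap.fst ℝ EX F).comp
      (e : E →L[ℝ] EX × F)).hasFDerivAt (x := a g)
    exact (DFunLike.congr_fun h3.fderiv v).symm.trans h2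
  have hrv : fderiv ℝ r (a g) v = v := by
    rw [hdr, ← hv1]
    exact e.symm_apply_apply v
  have hdu : tderiv E E (fun y => a.symm (r y)) (a g) v = η := by
    rw [tderiv_comp E E E (g := a.symm) (f := r) (hsymm.mdifferentiableAt (by simp))
      (hr.contMDiff.mdifferentiableAt (by simp)), ContinuousLinearMap.comp_apply,
      tderiv_eq_fderiv, hrv, hrg, hv, ← ContinuousLinearMap.comp_apply,
      ← tderiv_comp E E E (g := a.symm) (f := a)
        ((contMDiffAt_symm_of_mem_maximalAtlas h.domChart_mem_maximalAtlas
          (a.map_source hga)).mdifferentiableAt (by simp)) (hasm.mdifferentiableAt (by simp)),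
      tderiv_congr E E (g := fun y => y), tderiv_id]
    · rfl
    · filter_upwards [a.open_source.mem_nhds hga] with y hy
      exact a.left_inv hy
  have hmem : logDeriv E E (fun y => a.symm (r y)) (a g) v ∈ subgroupLie (E := E) H := by
    refine logDeriv_mem_subgroupLie hu ?_ v
    have ht : ∀ᶠ y in 𝓝 (a g), r y ∈ a.target := by
      refine hr.continuous.continuousAt.eventually (a.open_target.mem_nhds ?_)
      rw [hrg]; exact a.map_source hga
    filter_upwards [ht] with y hy
    rw [hug]
    refine QuotientGroup.eq.1 ?_
    have h1 := key (r y) hy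
    have h2 := key (a g) (a.map_source hga)
    rw [a.left_inv hga] at h2
    have h3 : (e (r y)).1 = (e (a g)).1 := by
      simp only [r, ContinuousLinearEquiv.apply_symm_apply]
    exact c.injOn hgc (h.source_subset_preimage_source (a.map_target hy)) (by rw [h1, h2, h3])
  rw [logDeriv, ContinuousLinearMap.comp_apply, hdu, hug] at hmem
  exact hmem

variable [FiniteDimensional ℝ E]

/-- The definition uses a chosen representative k of gH and a chosen lift. Writing g = kh, right
translation by h moves the chosen lift to g, where it differs from η by a vertical vector that
pr_{𝔥^⊥} kills. The remaining Ad(h⁻¹) commutes with pr_{𝔥^⊥} because the metric is bi-invariant. -/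
theorem coisotropyForm_apply {met : Metric E G} (hmet : IsBiInvariant met)
    (hπ : IsQuotientStructure E EX H) (g : G) (η : E) :
    (coisotropyForm met hπ).val (g : G ⧸ H)
      ![tderiv E EX (QuotientGroup.mk : G → G ⧸ H) g η] =
      Ad E g (prPerp met (subgroupLie H) (tderiv E E (fun x : G => g⁻¹ * x) g η)) := by
  have hmk := contMDiff_quotient_mk hπ
  set S := tderiv E EX (QuotientGroup.mk : G → G ⧸ H) g η with hS
  set k : G := (g : G ⧸ H).out with hk
  obtain ⟨η', hη', hval⟩ : ∃ η' : E, tderiv E EX (QuotientGroup.mk : G → G ⧸ H) k η' = S ∧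
      (coisotropyForm met hπ).val (g : G ⧸ H) ![S] =
        Ad E k (prPerp met (subgroupLie H) (tderiv E E (fun x : G => k⁻¹ * x) k η')) :=
    ⟨_, (exists_lift hπ (g : G ⧸ H).out).choose_spec S, rfl⟩
  obtain ⟨h, hh, hg⟩ : ∃ h ∈ H, g = k * h :=
    ⟨k⁻¹ * g, QuotientGroup.eq.1 (QuotientGroup.out_eq' _), by simp⟩
  have hR : ContMDiff 𝓘(ℝ, E) 𝓘(ℝ, E) ∞ (fun y : G => y * h) := contMDiff_mul_right
  have h1 : tderiv E EX (QuotientGroup.mk : G → G ⧸ H) g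
      (η - tderiv E E (fun y : G => y * h) k η') = 0 := by
    have h2 := tderiv_comp E E EX (g := (QuotientGroup.mk : G → G ⧸ H))
      (f := fun y : G => y * h) (x := k) (hmk.mdifferentiableAt (by simp))
      (hR.mdifferentiableAt (by simp))
    rw [show (fun y : G => ((y * h : G) : G ⧸ H)) = QuotientGroup.mk from
      funext fun y => QuotientGroup.mk_mul_of_mem y hh, ← hg] at h2
    rw [map_sub, ← ContinuousLinearMap.comp_apply, ← h2, hη', hS, sub_self]
  have h3 := prPerp_of_mem (met := met) (tderiv_inv_mul_mem_subgroupLie hπ h1)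
  have h4 : tderiv E E (fun x : G => g⁻¹ * x) g (tderiv E E (fun y : G => y * h) k η') =
      Ad E h⁻¹ (tderiv E E (fun x : G => k⁻¹ * x) k η') := by
    have h5 := DFunLike.congr_fun (logDeriv_mul_const (u := fun y : G => y) (x := k)
      (E := E) (EM := E) mdifferentiableAt_id h) η'
    rw [logDeriv, logDeriv, tderiv_id, ← hg] at h5
    exact h5
  rw [map_sub, map_sub, h4, prPerp_Ad_subgroup hmet (H.inv_mem hh), sub_eq_zero] at h3
  have h6 : k = g * h⁻¹ := by rw [hg, mul_inv_cancel_right]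
  rw [hval, h3, h6, Ad_mul]
  rfl

end Quotient

/-! ### The coset bundle -/

section Bundle

open CosetBundle

variable {E : Type*} [NormedAddCommGroup E] [NormedSpace ℝ E] [FiniteDimensional ℝ E]
  {G : Type*} [TopologicalSpace G] [ChartedSpace E G] [Group G] [LieGroup 𝓘(ℝ, E) ∞ G]
  {H : Subgroup G}
  {EM : Type*} [NormedAddCommGroup EM] [NormedSpace ℝ EM]
  {M : Type*} [TopologicalSpace M] [ChartedSpace EM M] [IsManifold 𝓘(ℝ, EM) ∞ M]
  {φ : M → G ⧸ H}
  {EP : Type*} [NormedAddCommGroup EP] [NormedSpace ℝ EP] [ChartedSpace EP (CosetBundle φ)]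
  [IsManifold 𝓘(ℝ, EP) ∞ (CosetBundle φ)]
  {EN : Type*} [NormedAddCommGroup EN] [NormedSpace ℝ EN]
  {N : Type*} [TopologicalSpace N] [ChartedSpace EN N]

omit [FiniteDimensional ℝ E] [LieGroup 𝓘(ℝ, E) ∞ G] [IsManifold 𝓘(ℝ, EM) ∞ M]
  [IsManifold 𝓘(ℝ, EP) ∞ (CosetBundle φ)] in
theorem contMDiff_π₁ (hP : IsSubmanifoldStructure E EM φ EP) :
    ContMDiff 𝓘(ℝ, EP) 𝓘(ℝ, EM) ∞ (π₁ : CosetBundle φ → M) :=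
  contMDiff_fst.comp hP.contMDiff

omit [FiniteDimensional ℝ E] [LieGroup 𝓘(ℝ, E) ∞ G] [IsManifold 𝓘(ℝ, EM) ∞ M]
  [IsManifold 𝓘(ℝ, EP) ∞ (CosetBundle φ)] in
theorem contMDiff_π₂ (hP : IsSubmanifoldStructure E EM φ EP) :
    ContMDiff 𝓘(ℝ, EP) 𝓘(ℝ, E) ∞ (π₂ : CosetBundle φ → G) :=
  contMDiff_snd.comp hP.contMDiff

omit [FiniteDimensional ℝ E] [IsManifold 𝓘(ℝ, EM) ∞ M]
  [IsManifold 𝓘(ℝ, EP) ∞ (CosetBundle φ)] in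
-- Universal property of an embedded submanifold: the topological embedding gives continuity, and
-- the immersion then gives smoothness.
theorem contMDiffAt_of_π₁_π₂ [IsManifold 𝓘(ℝ, EN) ∞ N] (hP : IsSubmanifoldStructure E EM φ EP)
    {f : N → CosetBundle φ} {x : N}
    (h1 : ContMDiffAt 𝓘(ℝ, EN) 𝓘(ℝ, EM) ∞ (fun y => π₁ (f y)) x)
    (h2 : ContMDiffAt 𝓘(ℝ, EN) 𝓘(ℝ, E) ∞ (fun y => π₂ (f y)) x) :
    ContMDiffAt 𝓘(ℝ, EN) 𝓘(ℝ, EP) ∞ f x := by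
  have hG : IsManifold 𝓘(ℝ, E) ∞ G := inferInstance
  have h : ContMDiffAt 𝓘(ℝ, EN) (𝓘(ℝ, EM).prod 𝓘(ℝ, E)) ∞
      ((Subtype.val : CosetBundle φ → M × G) ∘ f) x := h1.prodMk h2
  rw [ContMDiffAt.iff_comp_isImmersionAt (hP.isImmersion.isImmersionAt _)]
  exact ⟨hP.isEmbedding.isInducing.continuousAt_iff.2 h.continuousAt, h⟩

theorem contMDiff_gaugeMap (hP : IsSubmanifoldStructure E EM φ EP) {w : M → G}
    (hw : ContMDiff 𝓘(ℝ, EM) 𝓘(ℝ, E) ∞ w) (hwφ : ∀ m, w m ∈ MulAction.stabilizer G (φ m)) :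
    ContMDiff 𝓘(ℝ, EP) 𝓘(ℝ, EP) ∞ (gaugeMap w hwφ) := fun _ =>
  contMDiffAt_of_π₁_π₂ hP (contMDiff_π₁ hP).contMDiffAt
    ((hw.comp (contMDiff_π₁ hP)).mul (contMDiff_π₂ hP)).contMDiffAt

variable {EX : Type*} [NormedAddCommGroup EX] [NormedSpace ℝ EX] [ChartedSpace EX (G ⧸ H)]
  [IsManifold 𝓘(ℝ, EX) ∞ (G ⧸ H)]

/-- Since φ ∘ π₁ = π ∘ π₂, the pullback of φ^*ω^⊥ to the bundle is also π₂^*π^*ω^⊥, which is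
explicit. -/
theorem coisotropyForm_pullback_apply {met : Metric E G} (hmet : IsBiInvariant met)
    (hπ : IsQuotientStructure E EX H) (hφ : ContMDiff 𝓘(ℝ, EM) 𝓘(ℝ, EX) ∞ φ)
    (hP : IsSubmanifoldStructure E EM φ EP) (p : CosetBundle φ) (X : EP) :
    ((coisotropyForm met hπ).pullback φ : DForm EM M E 1).val (π₁ p)
      ![tderiv EP EM (π₁ : CosetBundle φ → M) p X] =
      Ad E (π₂ p) (prPerp met (subgroupLie H)
        (logDeriv E EP (π₂ : CosetBundle φ → G) p X)) := by
  have h1 := tderiv_comp EP EM EX (g := φ) (f := (π₁ : CosetBundle φ → M)) (x := p)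
    (hφ.mdifferentiableAt (by simp)) ((contMDiff_π₁ hP).mdifferentiableAt (by simp))
  have h2 := tderiv_comp EP E EX (g := (QuotientGroup.mk : G → G ⧸ H))
    (f := (π₂ : CosetBundle φ → G)) (x := p)
    ((contMDiff_quotient_mk hπ).mdifferentiableAt (by simp))
    ((contMDiff_π₂ hP).mdifferentiableAt (by simp))
  rw [show (fun q : CosetBundle φ => φ (π₁ q)) = fun q => ((π₂ q : G) : G ⧸ H) from
    funext fun q => q.2, h2] at h1
  have h3 := DFunLike.congr_fun h1 X
  rw [DForm.val_pullback, compContinuousLinearMap_apply_one]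
  rw [ContinuousLinearMap.comp_apply, ContinuousLinearMap.comp_apply] at h3
  rw [← h3, show φ (π₁ p) = ((π₂ p : G) : G ⧸ H) from p.2, coisotropyForm_apply hmet hπ]
  rfl

/-- Through every point of the coset bundle there passes a smooth local section. -/
theorem exists_bundle_section (hπ : IsQuotientStructure E EX H)
    (hφ : ContMDiff 𝓘(ℝ, EM) 𝓘(ℝ, EX) ∞ φ) (hP : IsSubmanifoldStructure E EM φ EP)
    (p : CosetBundle φ) :
    ∃ s : M → CosetBundle φ, s (π₁ p) = p ∧ ContMDiffAt 𝓘(ℝ, EM) 𝓘(ℝ, EP) ∞ s (π₁ p) ∧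
      ∀ᶠ m in 𝓝 (π₁ p), π₁ (s m) = m := by
  classical
  obtain ⟨σ, hσ, hσs, hσe⟩ := exists_local_section hπ (π₂ p)
  have hp : φ (π₁ p) = ((π₂ p : G) : G ⧸ H) := p.2
  rw [← hp] at hσ hσs hσe
  have hev : ∀ᶠ m in 𝓝 (π₁ p), φ m = (σ (φ m) : G ⧸ H) :=
    (hφ.continuous.continuousAt.eventually hσe).mono fun _ h => h.symm
  -- The section is m ↦ (m, σ(φ m)) for a local section σ of π; the default value p is only taken
  -- away from π₁ p.
  let s : M → CosetBundle φ := fun m =>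
    if h : φ m = (σ (φ m) : G ⧸ H) then ⟨(m, σ (φ m)), h⟩ else p
  have h1 : ∀ᶠ m in 𝓝 (π₁ p), π₁ (s m) = m := hev.mono fun m h => by simp only [s, dif_pos h]; rfl
  have h2 : ∀ᶠ m in 𝓝 (π₁ p), π₂ (s m) = σ (φ m) :=
    hev.mono fun m h => by simp only [s, dif_pos h]; rfl
  refine ⟨s, ?_, contMDiffAt_of_π₁_π₂ hP (contMDiffAt_id.congr_of_eventuallyEq h1)
    ((ContMDiffAt.comp (g := σ) _ hσs hφ.contMDiffAt).congr_of_eventuallyEq h2), h1⟩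
  refine Subtype.ext (Prod.ext h1.self_of_nhds ?_)
  exact h2.self_of_nhds.trans hσ

omit [FiniteDimensional ℝ E] [IsManifold 𝓘(ℝ, EM) ∞ M] [LieGroup 𝓘(ℝ, E) ∞ G] [TopologicalSpace M]
  [ChartedSpace EM M] [ChartedSpace E G] [TopologicalSpace G] in
theorem π₁_surjective : Function.Surjective (π₁ : CosetBundle φ → M) := fun m => by
  obtain ⟨g, hg⟩ := QuotientGroup.mk_surjective (φ m)
  exact ⟨⟨(m, g), hg.symm⟩, rfl⟩

variable {V : Type*} [NormedAddCommGroup V] [NormedSpace ℝ V] {k : ℕ}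

omit [FiniteDimensional ℝ E] in
-- π₁ ∘ s is the identity near m, so pulling back by π₁ and then by s restores the form.
theorem pullback_section_val (hP : IsSubmanifoldStructure E EM φ EP) (α : DForm EM M V k)
    {s : M → CosetBundle φ} {m : M} (hs : ContMDiffAt 𝓘(ℝ, EM) 𝓘(ℝ, EP) ∞ s m)
    (h1 : ∀ᶠ y in 𝓝 m, π₁ (s y) = y) :
    ∀ᶠ y in 𝓝 m,
      ((α.pullback (π₁ : CosetBundle φ → M) : DForm EP (CosetBundle φ) V k).pullback s :
        DForm EM M V k).val y = α.val y := by
  filter_upwards [ContMDiffAt.eventually_mdifferentiableAt hs, h1.eventually_nhds] with y hy hy1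
  have h2 := tderiv_comp EM EP EM (g := (π₁ : CosetBundle φ → M)) (f := s) (x := y)
    ((contMDiff_π₁ hP).mdifferentiableAt (by simp)) hy
  rw [tderiv_congr EM EM (g := fun y : M => y) hy1, tderiv_id] at h2
  have h3 : ((α.pullback (π₁ : CosetBundle φ → M) : DForm EP (CosetBundle φ) V k).pullback s :
        DForm EM M V k).val y = (α.val (π₁ (s y))).compContinuousLinearMap
          (tderiv EP EM (π₁ : CosetBundle φ → M) (s y) ∘L tderiv EM EP s y) := rfl
  rw [h3, ← h2, hy1.self_of_nhds]
  rfl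

theorem pullback_π₁_injective (hπ : IsQuotientStructure E EX H)
    (hφ : ContMDiff 𝓘(ℝ, EM) 𝓘(ℝ, EX) ∞ φ) (hP : IsSubmanifoldStructure E EM φ EP) :
    Function.Injective (fun α : DForm EM M V k =>
      (α.pullback (π₁ : CosetBundle φ → M) : DForm EP (CosetBundle φ) V k)) := by
  intro α β h
  refine DForm.ext_val fun m => ?_
  obtain ⟨p, rfl⟩ := π₁_surjective (φ := φ) m
  obtain ⟨s, -, hs, hs1⟩ := exists_bundle_section hπ hφ hP p
  dsimp only at h
  rw [← (pullback_section_val hP α hs hs1).self_of_nhds, h,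
    (pullback_section_val hP β hs hs1).self_of_nhds]

theorem isSmooth_of_pullback_π₁ (hπ : IsQuotientStructure E EX H)
    (hφ : ContMDiff 𝓘(ℝ, EM) 𝓘(ℝ, EX) ∞ φ) (hP : IsSubmanifoldStructure E EM φ EP)
    {α : DForm EM M V k}
    (h : (α.pullback (π₁ : CosetBundle φ → M) : DForm EP (CosetBundle φ) V k).IsSmooth) :
    α.IsSmooth := by
  refine DForm.isSmooth_of_isSmoothAt fun m => ?_
  obtain ⟨p, rfl⟩ := π₁_surjective (φ := φ) m
  obtain ⟨s, -, hs, hs1⟩ := exists_bundle_section hπ hφ hP p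
  refine ((h.isSmoothAt _).pullback hs).congr ?_
  filter_upwards [pullback_section_val hP α hs hs1] with y hy using hy.symm

end Bundle

/-! ### Potentials, gauge transformations and curvature -/

section Potential

open CosetBundle

variable {E : Type*} [NormedAddCommGroup E] [NormedSpace ℝ E] [FiniteDimensional ℝ E]
  {G : Type*} [TopologicalSpace G] [ChartedSpace E G] [Group G] [LieGroup 𝓘(ℝ, E) ∞ G]
  {H : Subgroup G}
  {EM : Type*} [NormedAddCommGroup EM] [NormedSpace ℝ EM]
  {M : Type*} [TopologicalSpace M] [ChartedSpace EM M]
  {φ : M → G ⧸ H}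
  {EP : Type*} [NormedAddCommGroup EP] [NormedSpace ℝ EP] [ChartedSpace EP (CosetBundle φ)]
  {met : Metric E G} {B : DForm EP (CosetBundle φ) E 1} {b : DForm EM M E 1}

/-- Inverting Ad(g) puts the definition in the solved form B = Ad(g⁻¹) π₁^*b + pr_𝔥 θ, the only one
used in the computations. -/
theorem potential_eq_iff :
    (B - (trivialForm (G := G)).mapCoeff (fun _ => prPar met (subgroupLie H))).mapCoeff
      (fun p => Ad E (π₂ p)) = b.pullback (π₁ : CosetBundle φ → M) ↔
    ∀ (p : CosetBundle φ) (X : EP), B.val p ![X] =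
      Ad E (π₂ p)⁻¹ (b.val (π₁ p) ![tderiv EP EM (π₁ : CosetBundle φ → M) p X]) +
        prPar met (subgroupLie H) (logDeriv E EP (π₂ : CosetBundle φ → G) p X) := by
  have key : ∀ (p : CosetBundle φ) (X : EP),
      ((B - (trivialForm (G := G)).mapCoeff (fun _ => prPar met (subgroupLie H))).mapCoeff
        (fun p => Ad E (π₂ p))).val p ![X] = Ad E (π₂ p) (B.val p ![X] -
          prPar met (subgroupLie H) (logDeriv E EP (π₂ : CosetBundle φ → G) p X)) :=
    fun p X => rfl
  have key' : ∀ (p : CosetBundle φ) (X : EP),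
      (b.pullback (π₁ : CosetBundle φ → M) : DForm EP (CosetBundle φ) E 1).val p ![X] =
        b.val (π₁ p) ![tderiv EP EM (π₁ : CosetBundle φ → M) p X] := fun p X => by
    rw [DForm.val_pullback, compContinuousLinearMap_apply_one]
  constructor
  · intro h p X
    rw [← key', ← h, key, Ad_inv_apply, sub_add_cancel]
  · intro h
    refine DForm.ext_val fun p => alternating_one_ext fun X => ?_
    rw [key, key', h, add_sub_cancel_right, Ad_apply_inv]

theorem curvaturePotential_eq_iff {R : DForm EM M E 2} :
    (curvature B).mapCoeff (fun p => Ad E (π₂ p)) = R.pullback (π₁ : CosetBundle φ → M) ↔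
    ∀ (p : CosetBundle φ) (X Y : EP), (curvature B).val p ![X, Y] =
      Ad E (π₂ p)⁻¹ (R.val (π₁ p) ![tderiv EP EM (π₁ : CosetBundle φ → M) p X,
        tderiv EP EM (π₁ : CosetBundle φ → M) p Y]) := by
  have key : ∀ (p : CosetBundle φ) (X Y : EP),
      ((curvature B).mapCoeff (fun p => Ad E (π₂ p))).val p ![X, Y] =
        Ad E (π₂ p) ((curvature B).val p ![X, Y]) := fun p X Y => rfl
  have key' : ∀ (p : CosetBundle φ) (X Y : EP),
      (R.pullback (π₁ : CosetBundle φ → M) : DForm EP (CosetBundle φ) E 2).val p ![X, Y] =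
        R.val (π₁ p) ![tderiv EP EM (π₁ : CosetBundle φ → M) p X,
        tderiv EP EM (π₁ : CosetBundle φ → M) p Y] := fun p X Y => by
    rw [DForm.val_pullback, compContinuousLinearMap_apply_two]
  constructor
  · intro h p X Y
    rw [← key', ← h, key, Ad_inv_apply]
  · intro h
    refine DForm.ext_val fun p => alternating_two_ext fun X Y => ?_
    rw [key, key', h, Ad_apply_inv]

variable [IsManifold 𝓘(ℝ, EM) ∞ M]
  [IsManifold 𝓘(ℝ, EP) ∞ (CosetBundle φ)]
  {EX : Type*} [NormedAddCommGroup EX] [NormedSpace ℝ EX] [ChartedSpace EX (G ⧸ H)]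
  [IsManifold 𝓘(ℝ, EX) ∞ (G ⧸ H)]

theorem contMDiff_Ad_π₂ (hP : IsSubmanifoldStructure E EM φ EP) :
    ContMDiff 𝓘(ℝ, EP) 𝓘(ℝ, E →L[ℝ] E) ∞ (fun p : CosetBundle φ => Ad E (π₂ p)) :=
  contMDiff_Ad (contMDiff_π₂ hP)

theorem curvature_isSmooth (hB : B.IsSmooth) : (curvature B).IsSmooth :=
  hB.d.add hB.wedgeSelf

theorem curvature_pullback (hB : B.IsSmooth) {f : CosetBundle φ → CosetBundle φ}
    (hf : ContMDiff 𝓘(ℝ, EP) 𝓘(ℝ, EP) ∞ f) :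
    curvature (B.pullback f : DForm EP (CosetBundle φ) E 1) = (curvature B).pullback f := by
  have h1 : ((curvature B).pullback f : DForm EP (CosetBundle φ) E 2) =
    B.d.pullback f + (B.wedgeSelf G).pullback f := rfl
  rw [h1, ← DForm.d_pullback hB hf, DForm.wedgeSelf_pullback]
  rfl

/-- Once the identity holds upstairs for b, injectivity of π₁^* gives uniqueness, and smoothness of
b descends from that of B, θ and Ad(g). -/
theorem isPotential_iff (hπ : IsQuotientStructure E EX H)
    (hφ : ContMDiff 𝓘(ℝ, EM) 𝓘(ℝ, EX) ∞ φ) (hP : IsSubmanifoldStructure E EM φ EP)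
    (hB : B.IsSmooth)
    (h : ∀ (p : CosetBundle φ) (X : EP), B.val p ![X] =
      Ad E (π₂ p)⁻¹ (b.val (π₁ p) ![tderiv EP EM (π₁ : CosetBundle φ → M) p X]) +
        prPar met (subgroupLie H) (logDeriv E EP (π₂ : CosetBundle φ → G) p X))
    (b' : DForm EM M E 1) : IsPotential met B b' ↔ b' = b := by
  have heq := potential_eq_iff.2 h
  constructor
  · intro h'
    exact pullback_π₁_injective hπ hφ hP (h'.eq.symm.trans heq)
  · rintro rfl
    refine ⟨isSmooth_of_pullback_π₁ hπ hφ hP ?_, heq⟩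
    rw [← heq]
    exact (hB.sub (((maurerCartan_isSmooth E G).pullback (contMDiff_π₂ hP)).mapCoeff
      contMDiff_const)).mapCoeff (contMDiff_Ad_π₂ hP)

theorem isCurvaturePotential_iff (hπ : IsQuotientStructure E EX H)
    (hφ : ContMDiff 𝓘(ℝ, EM) 𝓘(ℝ, EX) ∞ φ) (hP : IsSubmanifoldStructure E EM φ EP)
    (hB : B.IsSmooth) {R : DForm EM M E 2}
    (h : ∀ (p : CosetBundle φ) (X Y : EP), (curvature B).val p ![X, Y] =
      Ad E (π₂ p)⁻¹ (R.val (π₁ p) ![tderiv EP EM (π₁ : CosetBundle φ → M) p X,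
        tderiv EP EM (π₁ : CosetBundle φ → M) p Y]))
    (R' : DForm EM M E 2) : IsCurvaturePotential B R' ↔ R' = R := by
  have heq := curvaturePotential_eq_iff.2 h
  constructor
  · intro h'
    exact pullback_π₁_injective hπ hφ hP (h'.eq.symm.trans heq)
  · rintro rfl
    refine ⟨isSmooth_of_pullback_π₁ hπ hφ hP ?_, heq⟩
    rw [← heq]
    exact (curvature_isSmooth hB).mapCoeff (contMDiff_Ad_π₂ hP)

/-! ### Behaviour under gauge transformations -/

section Gauge

variable {w : M → G}

theorem tderiv_π₁_gaugeMap (hwφ : ∀ m, w m ∈ MulAction.stabilizer G (φ m))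
    (hP : IsSubmanifoldStructure E EM φ EP)
    (hw : ContMDiff 𝓘(ℝ, EM) 𝓘(ℝ, E) ∞ w) (p : CosetBundle φ) (X : EP) :
    tderiv EP EM (π₁ : CosetBundle φ → M) (gaugeMap w hwφ p)
      (tderiv EP EP (gaugeMap w hwφ) p X) = tderiv EP EM (π₁ : CosetBundle φ → M) p X := by
  have h := tderiv_comp EP EP EM (g := (π₁ : CosetBundle φ → M)) (f := gaugeMap w hwφ) (x := p)
    ((contMDiff_π₁ hP).mdifferentiableAt (by simp))
    ((contMDiff_gaugeMap hP hw hwφ).mdifferentiableAt (by simp))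
  exact (DFunLike.congr_fun h X).symm

/-- Product rule for π₂ ∘ f_w = (w ∘ π₁) · π₂. -/
theorem logDeriv_π₂_gaugeMap (hwφ : ∀ m, w m ∈ MulAction.stabilizer G (φ m))
    (hP : IsSubmanifoldStructure E EM φ EP)
    (hw : ContMDiff 𝓘(ℝ, EM) 𝓘(ℝ, E) ∞ w) (p : CosetBundle φ) (X : EP) :
    logDeriv E EP (π₂ : CosetBundle φ → G) (gaugeMap w hwφ p)
      (tderiv EP EP (gaugeMap w hwφ) p X) = logDeriv E EP (π₂ : CosetBundle φ → G) p X +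
        Ad E (π₂ p)⁻¹ (logDeriv E EM w (π₁ p) (tderiv EP EM (π₁ : CosetBundle φ → M) p X)) := by
  have hw1 : MDifferentiableAt 𝓘(ℝ, EM) 𝓘(ℝ, E) w (π₁ p) := hw.mdifferentiableAt (by simp)
  have hp1 : MDifferentiableAt 𝓘(ℝ, EP) 𝓘(ℝ, EM) (π₁ : CosetBundle φ → M) p :=
    (contMDiff_π₁ hP).mdifferentiableAt (by simp)
  have h1 := logDeriv_comp (E := E) (u := (π₂ : CosetBundle φ → G)) (f := gaugeMap w hwφ) (x := p)
    ((contMDiff_π₂ hP).mdifferentiableAt (by simp))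
    ((contMDiff_gaugeMap hP hw hwφ).mdifferentiableAt (by simp))
  have h2 := logDeriv_mul (E := E) (a := fun q : CosetBundle φ => w (π₁ q))
    (b := (π₂ : CosetBundle φ → G)) (x := p) (hw1.comp p hp1)
    ((contMDiff_π₂ hP).mdifferentiableAt (by simp))
  rw [logDeriv_comp hw1 hp1] at h2
  exact (DFunLike.congr_fun (h1.symm.trans h2) X)

/-- The same map is also π₂ · κ with κ = g⁻¹wg, which is H-valued since w fixes φ. The product rule
now gives κ⁻¹dκ + Ad(κ⁻¹)θ, whose first term lies in 𝔥, and Ad(κ⁻¹) = Ad(g⁻¹) Ad(w⁻¹) Ad(g) commutes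
with pr_{𝔥^⊥}. -/
theorem prPerp_gauge (hwφ : ∀ m, w m ∈ MulAction.stabilizer G (φ m))
    (hmet : IsBiInvariant met) (hP : IsSubmanifoldStructure E EM φ EP)
    (hw : ContMDiff 𝓘(ℝ, EM) 𝓘(ℝ, E) ∞ w)
    (p : CosetBundle φ) (X : EP) :
    prPerp met (subgroupLie H) (logDeriv E EP (π₂ : CosetBundle φ → G) p X +
        Ad E (π₂ p)⁻¹ (logDeriv E EM w (π₁ p) (tderiv EP EM (π₁ : CosetBundle φ → M) p X))) =
      Ad E (π₂ p)⁻¹ (Ad E (w (π₁ p))⁻¹ (Ad E (π₂ p) (prPerp met (subgroupLie H)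
        (logDeriv E EP (π₂ : CosetBundle φ → G) p X)))) := by
  let κ : CosetBundle φ → G := fun q => (π₂ q)⁻¹ * (w (π₁ q) * π₂ q)
  have hκH : ∀ q, κ q ∈ H := fun q => by
    have h1 : ((π₂ q : G) : G ⧸ H) = ((w (π₁ q) * π₂ q : G) : G ⧸ H) :=
      q.2.symm.trans (gaugeMap w hwφ q).2
    exact QuotientGroup.eq.1 h1
  have hκ : ContMDiff 𝓘(ℝ, EP) 𝓘(ℝ, E) ∞ κ :=
    (contMDiff_π₂ hP).inv.mul ((hw.comp (contMDiff_π₁ hP)).mul (contMDiff_π₂ hP))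
  have hmem := logDeriv_mem_subgroupLie (H := H) (hκ.contMDiffAt (x := p))
    (Filter.Eventually.of_forall fun q => H.mul_mem (H.inv_mem (hκH p)) (hκH q)) X
  have h2 := logDeriv_mul (E := E) (a := (π₂ : CosetBundle φ → G)) (b := κ) (x := p)
    ((contMDiff_π₂ hP).mdifferentiableAt (by simp)) (hκ.mdifferentiableAt (by simp))
  rw [show (fun q => π₂ q * κ q) = fun q : CosetBundle φ => π₂ (gaugeMap w hwφ q) from
    funext fun q => mul_inv_cancel_left _ _, logDeriv_comp
    ((contMDiff_π₂ hP).mdifferentiableAt (by simp))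
    ((contMDiff_gaugeMap hP hw hwφ).mdifferentiableAt (by simp))] at h2
  have h3 := DFunLike.congr_fun h2 X
  rw [ContinuousLinearMap.comp_apply, logDeriv_π₂_gaugeMap hwφ hP hw] at h3
  rw [h3, add_apply, map_add, prPerp_of_mem hmem, zero_add,
    ContinuousLinearMap.comp_apply, prPerp_Ad_subgroup hmet (H.inv_mem (hκH p)),
    show (κ p)⁻¹ = (π₂ p)⁻¹ * ((w (π₁ p))⁻¹ * π₂ p) by simp [κ, mul_assoc], Ad_mul, Ad_mul]
  rfl

theorem gaugeTransform_val_apply (hwφ : ∀ m, w m ∈ MulAction.stabilizer G (φ m))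
    (p : CosetBundle φ) (X : EP) :
    (gaugeTransform w hwφ B).val p ![X] =
      B.val (gaugeMap w hwφ p) ![tderiv EP EP (gaugeMap w hwφ) p X] := by
  rw [gaugeTransform, DForm.val_pullback, compContinuousLinearMap_apply_one]

theorem gaugeTransform_apply (hwφ : ∀ m, w m ∈ MulAction.stabilizer G (φ m))
    (hmet : IsBiInvariant met) (hπ : IsQuotientStructure E EX H)
    (hφ : ContMDiff 𝓘(ℝ, EM) 𝓘(ℝ, EX) ∞ φ) (hP : IsSubmanifoldStructure E EM φ EP)
    (hw : ContMDiff 𝓘(ℝ, EM) 𝓘(ℝ, E) ∞ w) (hb : IsPotential met B b)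
    (p : CosetBundle φ) (X : EP) :
    (gaugeTransform w hwφ B).val p ![X] =
      Ad E (π₂ p)⁻¹ ((b.mapCoeff (fun m => Ad E (w m)⁻¹)
          + (maurerCartan E G).pullback w
          - ((coisotropyForm met hπ).pullback φ : DForm EM M E 1).mapCoeff
              (fun m => Ad E (w m)⁻¹ - ContinuousLinearMap.id ℝ E)).val (π₁ p)
        ![tderiv EP EM (π₁ : CosetBundle φ → M) p X]) +
        prPar met (subgroupLie H) (logDeriv E EP (π₂ : CosetBundle φ → G) p X) := by
  set Z := tderiv EP EM (π₁ : CosetBundle φ → M) p X with hZ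
  set θ := logDeriv E EP (π₂ : CosetBundle φ → G) p X with hθ
  have hR : (b.mapCoeff (fun m => Ad E (w m)⁻¹) + (maurerCartan E G).pullback w
      - ((coisotropyForm met hπ).pullback φ : DForm EM M E 1).mapCoeff
          (fun m => Ad E (w m)⁻¹ - ContinuousLinearMap.id ℝ E)).val (π₁ p) ![Z] =
      Ad E (w (π₁ p))⁻¹ (b.val (π₁ p) ![Z]) + logDeriv E EM w (π₁ p) Z -
        (Ad E (w (π₁ p))⁻¹ - ContinuousLinearMap.id ℝ E)
          (((coisotropyForm met hπ).pullback φ : DForm EM M E 1).val (π₁ p) ![Z]) := rfl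
  have h1 := prPerp_gauge hwφ hmet hP hw p X
  rw [← hZ, ← hθ] at h1
  -- The 𝔥-part of the transformed θ is found as the whole minus its 𝔥^⊥-part, which `prPerp_gauge`
  -- identifies.
  have h2 := prPar_add_prPerp (met := met) (subgroupLie H)
    (θ + Ad E (π₂ p)⁻¹ (logDeriv E EM w (π₁ p) Z))
  rw [h1] at h2
  rw [gaugeTransform_val_apply, potential_eq_iff.1 hb.eq, tderiv_π₁_gaugeMap hwφ hP hw,
    logDeriv_π₂_gaugeMap hwφ hP hw, hR, coisotropyForm_pullback_apply hmet hπ hφ hP,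
    ← hZ, ← hθ]
  rw [show π₂ (gaugeMap w hwφ p) = w (π₁ p) * π₂ p from rfl,
    show π₁ (gaugeMap w hwφ p) = π₁ p from rfl, mul_inv_rev, Ad_mul,
    ContinuousLinearMap.comp_apply, eq_sub_of_add_eq h2]
  simp only [map_add, map_sub, sub_apply, ContinuousLinearMap.id_apply,
    Ad_inv_apply]
  rw [prPerp_apply (W := subgroupLie H) θ]
  simp only [map_sub]
  abel

/-- Curvature commutes with f_w^*, and f_w covers the identity of M. The only change is Ad((wg)⁻¹) =
Ad(g⁻¹) Ad(w⁻¹). -/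
theorem curvature_gaugeTransform_apply (hwφ : ∀ m, w m ∈ MulAction.stabilizer G (φ m))
    (hP : IsSubmanifoldStructure E EM φ EP)
    (hw : ContMDiff 𝓘(ℝ, EM) 𝓘(ℝ, E) ∞ w) (hB : B.IsSmooth) {R : DForm EM M E 2}
    (hR : IsCurvaturePotential B R) (p : CosetBundle φ) (X Y : EP) :
    (curvature (gaugeTransform w hwφ B)).val p ![X, Y] =
      Ad E (π₂ p)⁻¹ ((R.mapCoeff (fun m => Ad E (w m)⁻¹)).val (π₁ p)
        ![tderiv EP EM (π₁ : CosetBundle φ → M) p X,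
          tderiv EP EM (π₁ : CosetBundle φ → M) p Y]) := by
  rw [gaugeTransform, curvature_pullback hB (contMDiff_gaugeMap hP hw hwφ), DForm.val_pullback,
    compContinuousLinearMap_apply_two, curvaturePotential_eq_iff.1 hR.eq,
    tderiv_π₁_gaugeMap hwφ hP hw, tderiv_π₁_gaugeMap hwφ hP hw,
    show π₂ (gaugeMap w hwφ p) = w (π₁ p) * π₂ p from rfl, mul_inv_rev, Ad_mul]
  rfl

end Gauge

/-! ### Curvature in terms of the untwisted potential -/

/-- The value of a connection form with potential `b` along a map into the coset bundle. -/
theorem potential_along (hP : IsSubmanifoldStructure E EM φ EP) (hb : IsPotential met B b)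
    {F : Type*} [NormedAddCommGroup F] [NormedSpace ℝ F] {e : F → CosetBundle φ} {x : F}
    (he : MDifferentiableAt 𝓘(ℝ, F) 𝓘(ℝ, EP) e x) (v : F) :
    B.along e x ![v] = Ad E (π₂ (e x))⁻¹ (b.along (fun y => π₁ (e y)) x ![v]) +
      prPar met (subgroupLie H) (logDeriv E F (fun y => π₂ (e y)) x v) := by
  have h1 := tderiv_comp F EP EM (g := (π₁ : CosetBundle φ → M)) (f := e) (x := x)
    ((contMDiff_π₁ hP).mdifferentiableAt (by simp)) he
  have h2 := logDeriv_comp (E := E) (u := (π₂ : CosetBundle φ → G)) (f := e) (x := x)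
    ((contMDiff_π₂ hP).mdifferentiableAt (by simp)) he
  rw [h2, DForm.along, DForm.along, compContinuousLinearMap_apply_one,
    compContinuousLinearMap_apply_one, potential_eq_iff.1 hb.eq, h1]
  rfl

theorem hasFDerivAt_Ad_inv_apply {F : Type*} [NormedAddCommGroup F] [NormedSpace ℝ F] {u : F → G}
    {c : F → E} {x : F} (hu : ContMDiffAt 𝓘(ℝ, F) 𝓘(ℝ, E) ∞ u x) (hc : DifferentiableAt ℝ c x) :
    DifferentiableAt ℝ (fun y => Ad E (u y)⁻¹ (c y)) x ∧
    ∀ v, fderiv ℝ (fun y => Ad E (u y)⁻¹ (c y)) x v =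
      Ad E (u x)⁻¹ (fderiv ℝ c x v) - bracketL E G (logDeriv E F u x v) (Ad E (u x)⁻¹ (c x)) := by
  have hA := ((contDiffAt_Ad_inv hu).differentiableAt (by simp)).hasFDerivAt
  have h1 := hA.clm_apply hc.hasFDerivAt
  refine ⟨h1.differentiableAt, fun v => ?_⟩
  have h2 := (contDiffAt_Ad_inv_apply hu (c x)).2 v
  rw [(hA.clm_apply (hasFDerivAt_const (c x) x)).fderiv] at h2
  rw [h1.fderiv]
  simp only [add_apply, ContinuousLinearMap.comp_apply,
    ContinuousLinearMap.flip_apply, zero_apply, map_zero, zero_add] at h2 ⊢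
  rw [h2, sub_eq_add_neg]

/-- Apply the Leibniz rule to B = Ad(g⁻¹) π₁^*b + pr_𝔥 θ. The derivative of Ad(g⁻¹) produces the two
bracket terms with θ, and dθ = -θ∧θ the projected one. -/
theorem d_potential_apply (hP : IsSubmanifoldStructure E EM φ EP) (hB : B.IsSmooth)
    (hb : IsPotential met B b) (p : CosetBundle φ) (X Y : EP) :
    B.d.val p ![X, Y] =
      Ad E (π₂ p)⁻¹ (b.d.val (π₁ p) ![tderiv EP EM (π₁ : CosetBundle φ → M) p X,
        tderiv EP EM (π₁ : CosetBundle φ → M) p Y])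
      - bracketL E G (logDeriv E EP (π₂ : CosetBundle φ → G) p X)
          (Ad E (π₂ p)⁻¹ (b.val (π₁ p) ![tderiv EP EM (π₁ : CosetBundle φ → M) p Y]))
      + bracketL E G (logDeriv E EP (π₂ : CosetBundle φ → G) p Y)
          (Ad E (π₂ p)⁻¹ (b.val (π₁ p) ![tderiv EP EM (π₁ : CosetBundle φ → M) p X]))
      - prPar met (subgroupLie H) (bracketL E G (logDeriv E EP (π₂ : CosetBundle φ → G) p X)
          (logDeriv E EP (π₂ : CosetBundle φ → G) p Y)) := by
  -- Everything is transported to the chart at p, whose inverse e has identity derivative at x.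
  set e : EP → CosetBundle φ := ⇑(extChartAt 𝓘(ℝ, EP) p).symm with he_def
  set x : EP := extChartAt 𝓘(ℝ, EP) p p with hx
  have hex : e x = p := extChartAt_to_inv p
  have he : ContMDiffAt 𝓘(ℝ, EP) 𝓘(ℝ, EP) ∞ e x :=
    contMDiffAt_chart_symm EP (mem_extChartAt_target p)
  have hte : tderiv EP EP e x = .id ℝ EP := tderiv_chart_symm_self EP p
  have hu : ContMDiffAt 𝓘(ℝ, EP) 𝓘(ℝ, E) ∞ (fun y => π₂ (e y)) x :=
    (contMDiff_π₂ hP).contMDiffAt.comp x he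
  have hq : ContMDiffAt 𝓘(ℝ, EP) 𝓘(ℝ, EM) ∞ (fun y => π₁ (e y)) x :=
    (contMDiff_π₁ hP).contMDiffAt.comp x he
  have hbs : ContDiffAt ℝ ∞ (b.along fun y => π₁ (e y)) x := (hb.smooth.isSmoothAt _).along hq
  have hBs : ContDiffAt ℝ ∞ (B.along e) x := (hB.isSmoothAt _).along he
  have happ : ∀ v : EP, DifferentiableAt ℝ (fun y => b.along (fun y => π₁ (e y)) y ![v]) x :=
    fun v => ((ContinuousAlternatingMap.apply ℝ EP E ![v]).differentiableAt).comp x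
      (hbs.differentiableAt (by simp))
  have hlog : ∀ v : EP, DifferentiableAt ℝ (fun y => logDeriv E EP (fun y => π₂ (e y)) y v) x :=
    fun v => ((contDiffAt_logDeriv hu).differentiableAt (by simp)).clm_apply
      (differentiableAt_const v)
  have hfd : ∀ v w : EP, fderiv ℝ (fun y => B.along e y ![w]) x v =
      Ad E (π₂ p)⁻¹ (fderiv ℝ (fun y => b.along (fun y => π₁ (e y)) y ![w]) x v)
      - bracketL E G (logDeriv E EP (fun y => π₂ (e y)) x v)
          (Ad E (π₂ p)⁻¹ (b.along (fun y => π₁ (e y)) x ![w]))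
      + prPar met (subgroupLie H)
          (fderiv ℝ (fun y => logDeriv E EP (fun y => π₂ (e y)) y w) x v) := fun v w => by
    have h1 : (fun y => B.along e y ![w]) =ᶠ[𝓝 x] fun y =>
        Ad E (π₂ (e y))⁻¹ (b.along (fun y => π₁ (e y)) y ![w]) +
        prPar met (subgroupLie H) (logDeriv E EP (fun y => π₂ (e y)) y w) := by
      filter_upwards [ContMDiffAt.eventually_mdifferentiableAt he] with y hy
      exact potential_along hP hb hy w
    obtain ⟨h2, h3⟩ := hasFDerivAt_Ad_inv_apply hu (happ w)
    have h4 := (prPar met (subgroupLie H)).hasFDerivAt.comp x (hlog w).hasFDerivAt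
    have h5 := h1.fderiv_eq.trans (h2.hasFDerivAt.add h4).fderiv
    rw [h5, add_apply, h3, hex]
    rfl
  have hb1 : ∀ v : EP, b.along (fun y => π₁ (e y)) x ![v] =
      b.val (π₁ p) ![tderiv EP EM (π₁ : CosetBundle φ → M) p v] := fun v => by
    have h1 := tderiv_comp EP EP EM (g := (π₁ : CosetBundle φ → M)) (f := e) (x := x)
      ((contMDiff_π₁ hP).mdifferentiableAt (by simp)) (he.mdifferentiableAt (by simp))
    rw [DForm.along, compContinuousLinearMap_apply_one, h1, hte, hex]
    rfl
  have hd1 : ∀ v w : EP, b.d.along (fun y => π₁ (e y)) x ![v, w] =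
      b.d.val (π₁ p) ![tderiv EP EM (π₁ : CosetBundle φ → M) p v,
        tderiv EP EM (π₁ : CosetBundle φ → M) p w] := fun v w => by
    have h1 := tderiv_comp EP EP EM (g := (π₁ : CosetBundle φ → M)) (f := e) (x := x)
      ((contMDiff_π₁ hP).mdifferentiableAt (by simp)) (he.mdifferentiableAt (by simp))
    rw [DForm.along, compContinuousLinearMap_apply_two, h1, hte, hex]
    rfl
  have hl1 : ∀ v : EP, logDeriv E EP (fun y => π₂ (e y)) x v =
      logDeriv E EP (π₂ : CosetBundle φ → G) p v := fun v => by
    have h1 := logDeriv_comp (E := E) (u := (π₂ : CosetBundle φ → G)) (f := e) (x := x)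
      ((contMDiff_π₂ hP).mdifferentiableAt (by simp)) (he.mdifferentiableAt (by simp))
    rw [h1, hte, hex]
    rfl
  have hdb := DForm.extDeriv_along (hb.smooth.isSmoothAt _) hq
  have hext := extDeriv_one_form_apply (hbs.differentiableAt (by simp)) X Y
  rw [hdb, hd1] at hext
  -- Flatness of θ, to which pr_𝔥 is applied below.
  have hmc := fderiv_logDeriv hu X Y
  rw [hl1, hl1] at hmc
  rw [DForm.val_d, DForm.inChart_eq_along, extDeriv_one_form_apply
    (hBs.differentiableAt (by simp)), hfd, hfd, hext, hl1, hl1, hb1, hb1, map_sub]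
  have h5 := congrArg (prPar met (subgroupLie H)) hmc
  rw [map_sub, map_neg] at h5
  rw [sub_eq_iff_eq_add] at h5
  rw [h5]
  abel

/-- With β = Ad(g⁻¹) π₁^*b, add (β+η)∧(β+η) to dB and split θ = η + p. What remains is Ad(g⁻¹) db +
β∧β - [β,p] - pr_𝔥(p∧p), and Ad(g) carries p to φ^*ω^⊥ and 𝔥 to 𝔥_φ. -/
theorem curvature_potential_apply (hmet : IsBiInvariant met) (hπ : IsQuotientStructure E EX H)
    (hφ : ContMDiff 𝓘(ℝ, EM) 𝓘(ℝ, EX) ∞ φ) (hP : IsSubmanifoldStructure E EM φ EP)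
    (hB : B.IsSmooth) (hb : IsPotential met B b) (p : CosetBundle φ) (X Y : EP) :
    (curvature B).val p ![X, Y] =
      Ad E (π₂ p)⁻¹ ((b.d + b.wedgeSelf G
          - b.bracket G ((coisotropyForm met hπ).pullback φ : DForm EM M E 1)
          - isotropicPart met φ
              (((coisotropyForm met hπ).pullback φ : DForm EM M E 1).wedgeSelf G)).val (π₁ p)
        ![tderiv EP EM (π₁ : CosetBundle φ → M) p X,
          tderiv EP EM (π₁ : CosetBundle φ → M) p Y]) := by
  have hd := d_potential_apply hP hB hb p X Y
  have hBX := potential_eq_iff.1 hb.eq p X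
  have hBY := potential_eq_iff.1 hb.eq p Y
  have hωX := coisotropyForm_pullback_apply hmet hπ hφ hP p X
  have hωY := coisotropyForm_pullback_apply hmet hπ hφ hP p Y
  set ω' := ((coisotropyForm met hπ).pullback φ : DForm EM M E 1)
  set Z := tderiv EP EM (π₁ : CosetBundle φ → M) p X
  set W := tderiv EP EM (π₁ : CosetBundle φ → M) p Y
  set θX := logDeriv E EP (π₂ : CosetBundle φ → G) p X
  set θY := logDeriv E EP (π₂ : CosetBundle φ → G) p Y
  have hL : (curvature B).val p ![X, Y] = B.d.val p ![X, Y] + wedgeSelf G (B.val p) ![X, Y] := rfl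
  have hR : (b.d + b.wedgeSelf G - b.bracket G ω' - isotropicPart met φ (ω'.wedgeSelf G)).val
      (π₁ p) ![Z, W] = b.d.val (π₁ p) ![Z, W] + wedgeSelf G (b.val (π₁ p)) ![Z, W]
        - bracketForm G (b.val (π₁ p)) (ω'.val (π₁ p)) ![Z, W]
        - prPar met (isotropyLie H (φ (π₁ p))) (wedgeSelf G (ω'.val (π₁ p)) ![Z, W]) := rfl
  rw [hL, hR, wedgeSelf_apply, wedgeSelf_apply, wedgeSelf_apply, bracketForm_apply, hωX, hωY, hd,
    hBX, hBY, show φ (π₁ p) = ((π₂ p : G) : G ⧸ H) from p.2, ← Ad_bracketL,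
    prPar_isotropyLie hmet]
  simp only [map_add, map_sub, Ad_bracketL, Ad_inv_apply, add_apply]
  have hX := prPar_add_prPerp (met := met) (subgroupLie H) θX
  have hY := prPar_add_prPerp (met := met) (subgroupLie H) θY
  have mX := prPar_mem (met := met) (subgroupLie H) θX
  have mY := prPar_mem (met := met) (subgroupLie H) θY
  set ηX := prPar met (subgroupLie H) θX
  set ηY := prPar met (subgroupLie H) θY
  have h1 := prPar_bracketL_prPerp hmet mX θY
  have h2 := prPar_bracketL_prPerp hmet mY θX
  have h3 : prPar met (subgroupLie H) (bracketL E G ηX ηY) = bracketL E G ηX ηY := by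
    have h := prPar_add_prPerp (met := met) (subgroupLie H) (bracketL E G ηX ηY)
    rwa [prPerp_bracketL_of_mem mX mY, add_zero] at h
  set pX := prPerp met (subgroupLie H) θX
  set pY := prPerp met (subgroupLie H) θY
  clear_value ηX ηY pX pY
  rw [← hX, ← hY]
  simp only [map_add, add_apply]
  -- Of pr_𝔥[θX,θY] only [ηX,ηY] and pr_𝔥[pX,pY] survive. The former, like the brackets of η with β,
  -- cancels against B∧B.
  rw [bracketL_skew pX ηY, map_neg, h1, h2, h3]
  set βX := Ad E (π₂ p)⁻¹ (b.val (π₁ p) ![Z])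
  set βY := Ad E (π₂ p)⁻¹ (b.val (π₁ p) ![W])
  rw [bracketL_skew ηY βX, bracketL_skew βX pY,
    bracketL_skew βY pX]
  abel

end Potential

end CosetGauge

end

theorem theoremT
    -- the Lie group `G` with a bi-invariant Riemannian metric and a closed subgroup `H`
    {E : Type*} [NormedAddCommGroup E] [NormedSpace ℝ E] [FiniteDimensional ℝ E]
    {G : Type*} [TopologicalSpace G] [ChartedSpace E G] [Group G] [LieGroup 𝓘(ℝ, E) ∞ G]
    (met : Metric E G) (hmet : IsBiInvariant met)
    (H : Subgroup G) (hH : IsClosed (H : Set G))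
    -- the homogeneous space `G/H` with its standard smooth structure
    {EX : Type*} [NormedAddCommGroup EX] [NormedSpace ℝ EX] [FiniteDimensional ℝ EX]
    [ChartedSpace EX (G ⧸ H)] [IsManifold 𝓘(ℝ, EX) ∞ (G ⧸ H)]
    (hπ : IsQuotientStructure E EX H)
    -- the manifold `M` and the smooth map `φ : M → G/H`
    {EM : Type*} [NormedAddCommGroup EM] [NormedSpace ℝ EM] [FiniteDimensional ℝ EM]
    {M : Type*} [TopologicalSpace M] [ChartedSpace EM M] [IsManifold 𝓘(ℝ, EM) ∞ M]
    (φ : M → G ⧸ H) (hφ : ContMDiff 𝓘(ℝ, EM) 𝓘(ℝ, EX) ∞ φ)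
    -- the coset bundle `φ^* G` with its standard smooth structure
    {EP : Type*} [NormedAddCommGroup EP] [NormedSpace ℝ EP] [FiniteDimensional ℝ EP]
    [ChartedSpace EP (CosetBundle φ)]
    [IsManifold 𝓘(ℝ, EP) ∞ (CosetBundle φ)]
    (hP : IsSubmanifoldStructure E EM φ EP)
    -- a connection `B` with potential `b` and a smooth section `w` of `H_φ`
    (B : DForm EP (CosetBundle φ) E 1)
    (hB : IsConnection (EM := EM) B)
    (b : DForm EM M E 1) (hb : IsPotential met B b)
    (w : M → G) (hw : ContMDiff 𝓘(ℝ, EM) 𝓘(ℝ, E) ∞ w)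
    (hwφ : ∀ m, w m ∈ MulAction.stabilizer G (φ m)) :
    -- (i) `b^w`, the potential of `f_w^* B`
    (∀ bw : DForm EM M E 1,
      IsPotential met (gaugeTransform w hwφ B) bw ↔
        bw = b.mapCoeff (fun m => Ad E (w m)⁻¹)
          + (maurerCartan E G).pullback w
          - ((coisotropyForm met hπ).pullback φ : DForm EM M E 1).mapCoeff
              (fun m => Ad E (w m)⁻¹ - ContinuousLinearMap.id ℝ E)) ∧
    -- (ii) `F(b^w)` in terms of `F(b)`
    (∀ Fb : DForm EM M E 2, IsCurvaturePotential B Fb →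
      ∀ Fbw : DForm EM M E 2,
        IsCurvaturePotential (gaugeTransform w hwφ B) Fbw ↔
          Fbw = Fb.mapCoeff (fun m => Ad E (w m)⁻¹)) ∧
    -- (iii) `F(b)`
    (∀ Fb : DForm EM M E 2,
      IsCurvaturePotential B Fb ↔
        Fb = b.d + b.wedgeSelf G
          - b.bracket G ((coisotropyForm met hπ).pullback φ : DForm EM M E 1)
          - isotropicPart met φ
              (((coisotropyForm met hπ).pullback φ : DForm EM M E 1).wedgeSelf G)) := by
  have hsm := hB.smooth
  refine ⟨fun bw => ?_, fun Fb hFb Fbw => ?_, fun Fb => ?_⟩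
  · exact isPotential_iff hπ hφ hP (hsm.pullback (contMDiff_gaugeMap hP hw hwφ))
      (gaugeTransform_apply hwφ hmet hπ hφ hP hw hb) bw
  · exact isCurvaturePotential_iff hπ hφ hP (hsm.pullback (contMDiff_gaugeMap hP hw hwφ))
      (curvature_gaugeTransform_apply hwφ hP hw hsm hFb) Fbw
  · exact isCurvaturePotential_iff hπ hφ hP hsm
      (curvature_potential_apply hmet hπ hφ hP hsm hb) Fb
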